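/- Let $p\ge 0$ be an integer and let $\pi$ be a log-concave probability density on $\mathbb{R}^p$ with respect to Lebesgue measure, i.e. a measurable function $\pi:\mathbb{R}^p\to[0,\infty)$ with $\int\pi=1$ and $\pi(a\theta+b\theta')\ge\pi(\theta)^{a}\pi(\theta')^{b}$ for all $\theta,\theta'\in\mathbb{R}^p$ and $a,b>0$ with $a+b=1$ (for instance $\pi=e^{-f}/\int e^{-f}$ with $f:\mathbb{R}^p\to\mathbb{R}$ convex and $e^{-f}$ integrable). For $\alpha\ge 0$ put $$\pi_\alpha(\theta)=\frac{\pi(\theta)e^{-\alpha\|\theta\|_2^2/2}}{\int_{\mathbb{R}^p}\pi(v)e^{-\alpha\|v\|_2^2/2}\,dv},\qquad \mu_2(\pi)=\int_{\mathbb{R}^p}\|\theta\|_2^2\,\pi(\theta)\,d\theta .$$ Let $d_{\rm TV}(\mu,\nu)=2\sup_A|\mu(A)-\nu(A)|$, the supremum being over measurable sets (for densities this is $\int|\pi-\pi_\alpha|$), and for $q\ge1$ let $$W_q(\mu,\nu)=\inf_{\gamma}\Big(\int\|\theta-\theta'\|_2^q\,\gamma(d\theta,d\theta')\Big)^{1/q},$$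 the infimum being over all couplings $\gamma$ of $\mu$ and $\nu$. (1) For every $p$, every log-concave density $\pi$ on $\mathbb{R}^p$ and every $\alpha\ge0$, $\;d_{\rm TV}(\pi,\pi_\alpha)\le\alpha\,\mu_2(\pi)$. (2) There are finite constants $C_q\ge 0$, $q\in[1,\infty)$, depending only on $q$, with $C_1\le22$ and $C_2\le111$, such that for every $q\in[1,\infty)$, every $p$, every log-concave density $\pi$ on $\mathbb{R}^p$ and every $\alpha\ge0$, $$W_q^q(\pi,\pi_\alpha)\le C_q\,\alpha\,\mu_2(\pi)^{(q+2)/2}.$$ -/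

import Mathlib

open MeasureTheory
open scoped ENNReal NNReal

noncomputable section

namespace LogConcaveSampling

/-- `π` is a log-concave probability density on `ℝᵖ` (with respect to Lebesgue measure).
The value `0` is allowed, i.e. the potential `-log π` may be `+∞` outside a convex set. -/
structure IsLogConcaveDensity {p : ℕ} (π : EuclideanSpace ℝ (Fin p) → ℝ) : Prop where
  measurable : Measurable π
  nonneg : ∀ x, 0 ≤ π x
  lintegral_eq_one : ∫⁻ x, ENNReal.ofReal (π x) = 1
  logConcave : ∀ x y : EuclideanSpace ℝ (Fin p), ∀ a b : ℝ, 0 < a → 0 < b → a + b = 1 →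
    π x ^ a * π y ^ b ≤ π (a • x + b • y)

/-- The surrogate density `π_α ∝ π(θ) exp(-α ‖θ‖² / 2)`, normalised to have integral one. -/
def surrogate {p : ℕ} (α : ℝ) (π : EuclideanSpace ℝ (Fin p) → ℝ) :
    EuclideanSpace ℝ (Fin p) → ℝ := fun θ =>
  (π θ * Real.exp (-(α * ‖θ‖ ^ 2 / 2))) / ∫ v, π v * Real.exp (-(α * ‖v‖ ^ 2 / 2))

/-- The measure on `ℝᵖ` with density `π` with respect to Lebesgue measure. -/
def law {p : ℕ} (π : EuclideanSpace ℝ (Fin p) → ℝ) : Measure (EuclideanSpace ℝ (Fin p)) :=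
  volume.withDensity fun θ => ENNReal.ofReal (π θ)

/-- The second moment `μ₂ = E ‖ϑ‖²`. -/
def secondMoment {p : ℕ} (μ : Measure (EuclideanSpace ℝ (Fin p))) : ℝ≥0∞ :=
  ∫⁻ θ, ‖θ‖ₑ ^ 2 ∂μ

/-- The total-variation distance, normalised as the total mass of `|μ - ν|`. For probability
measures this is twice the largest discrepancy `|μ A - ν A|` over measurable sets `A`, and for
measures with densities it is the `L¹` distance of the densities. -/
def tvDist {p : ℕ} (μ ν : Measure (EuclideanSpace ℝ (Fin p))) : ℝ≥0∞ :=
  2 * ⨆ (A : Set (EuclideanSpace ℝ (Fin p))) (_ : MeasurableSet A),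
    ENNReal.ofReal |μ.real A - ν.real A|

/-- The couplings of `μ` and `ν`: measures on the product with marginals `μ` and `ν`. -/
def couplings {p : ℕ} (μ ν : Measure (EuclideanSpace ℝ (Fin p))) :
    Set (Measure (EuclideanSpace ℝ (Fin p) × EuclideanSpace ℝ (Fin p))) :=
  {γ | γ.map Prod.fst = μ ∧ γ.map Prod.snd = ν}

/-- The Monge-Kantorovich-Wasserstein distance
`W_q(μ, ν) = inf E[‖ϑ - ϑ'‖^q]^(1/q)`, the infimum being over all couplings. -/
def wasserstein {p : ℕ} (q : ℝ) (μ ν : Measure (EuclideanSpace ℝ (Fin p))) : ℝ≥0∞ :=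
  ⨅ γ ∈ couplings μ ν, (∫⁻ z, ‖z.1 - z.2‖ₑ ^ q ∂γ) ^ (1 / q)

end LogConcaveSampling

end

namespace LogConcaveSampling

/-! The normaliser of π_α is at most 1, so π - π_α ≤ π(1 - e^{-α‖θ‖²/2}) ≤ (α/2)‖θ‖²π pointwise.
Both densities have mass 1, so their L¹ distance is twice the integral of the positive part of π -
π_α; this gives (1).

For (2), leave the common mass min(π, π_α) in place and couple the residuals independently. The
ratio π_α/π is radially nonincreasing, so the residual of π_α lies no farther from the origin than
that of π, and mass at θ travels at most 2‖θ‖. Hence W_q^q ≤ 2^q ∫ ‖θ‖^q (π - π_α)⁺ ≤ 2^{q-1} α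
E‖θ‖^{q+2}.

It remains to bound E‖θ‖^k, k = q + 2, by (E‖θ‖²)^{k/2} with a dimension-free constant
(`IsLogConcaveDensity.moment_le`). Minkowski's inequality in L^{k/2}, applied to ‖θ‖² = ∑ θ_i²,
reduces this to the coordinates, whose laws are log-concave by Prékopa's theorem
(`LogConcave.lmarginal`). On a half-line of mass at least 1/2 a log-concave density is compared with
an exponential of equal mass (`LogConcave.lintegral_rpow_le_exp`); the lighter half-line is first
extended to the median (`LogConcave.moment_le_of_Ioi_le_half`). -/

/-! ### Brunn–Minkowski and Prékopa–Leindler on the line. -/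

theorem volume_le_iSup_inter_Iic {A : Set ℝ} (hA : MeasurableSet A) :
    volume A ≤ ⨆ a ∈ A, volume (A ∩ Set.Iic a) := by
  refine le_of_forall_lt fun c hc => ?_
  -- `A` may have no greatest point, but a compact subset of nearly full measure has one, and it
  -- belongs to `A`.
  obtain ⟨K, hKA, hK, hcK⟩ := hA.exists_lt_isCompact hc
  have hKne : K.Nonempty := by
    by_contra h
    simp [Set.not_nonempty_iff_eq_empty.1 h] at hcK
  obtain ⟨a, haK, ha⟩ := hK.exists_isGreatest hKne
  have hsub : K ⊆ A ∩ Set.Iic a := fun x hx => ⟨hKA hx, ha hx⟩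
  exact hcK.trans_le ((measure_mono hsub).trans
    (le_iSup₂ (f := fun a _ => volume (A ∩ Set.Iic a)) a (hKA haK)))

theorem volume_le_iSup_inter_Ici {A : Set ℝ} (hA : MeasurableSet A) :
    volume A ≤ ⨆ a ∈ A, volume (A ∩ Set.Ici a) := by
  refine le_of_forall_lt fun c hc => ?_
  obtain ⟨K, hKA, hK, hcK⟩ := hA.exists_lt_isCompact hc
  have hKne : K.Nonempty := by
    by_contra h
    simp [Set.not_nonempty_iff_eq_empty.1 h] at hcK
  obtain ⟨a, haK, ha⟩ := hK.exists_isLeast hKne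
  have hsub : K ⊆ A ∩ Set.Ici a := fun x hx => ⟨hKA hx, ha hx⟩
  exact hcK.trans_le ((measure_mono hsub).trans
    (le_iSup₂ (f := fun a _ => volume (A ∩ Set.Ici a)) a (hKA haK)))

/-- One-dimensional Brunn--Minkowski inequality. -/
theorem volume_add_volume_le_of_add_mem {A B C : Set ℝ} (hA : A.Nonempty) (hB : B.Nonempty)
    (hAm : MeasurableSet A) (hBm : MeasurableSet B) (h : ∀ x ∈ A, ∀ y ∈ B, x + y ∈ C) :
    volume A + volume B ≤ volume C := by
  refine (add_le_add (volume_le_iSup_inter_Iic hAm) (volume_le_iSup_inter_Ici hBm)).trans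
    (ENNReal.biSup_add_biSup_le hA hB fun a ha b hb => ?_)
  have e1 : volume (A ∩ Set.Iic a) = volume ((fun x => x + b) '' (A ∩ Set.Iic a)) := by
    rw [Set.image_add_right, measure_preimage_add_right]
  have e2 : volume (B ∩ Set.Ici b) = volume ((fun x => a + x) '' (B ∩ Set.Ici b)) := by
    rw [Set.image_add_left, measure_preimage_add]
  have hm : MeasurableSet ((fun x => a + x) '' (B ∩ Set.Ici b)) := by
    rw [Set.image_add_left]
    exact (measurable_const_add _) (hBm.inter measurableSet_Ici)
  -- The translates of the truncated sets lie on opposite sides of `a + b`, so they overlap in at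
  -- most that point, and both lie in `C`.
  have hd : AEDisjoint volume ((fun x => x + b) '' (A ∩ Set.Iic a))
      ((fun x => a + x) '' (B ∩ Set.Ici b)) := by
    refine measure_mono_null (t := {a + b}) ?_ (measure_singleton _)
    rintro _ ⟨⟨x, ⟨_, hx⟩, rfl⟩, ⟨y, ⟨_, hy⟩, hxy⟩⟩
    simp only [Set.mem_Iic, Set.mem_Ici, Set.mem_singleton_iff] at *
    linarith
  rw [e1, e2, ← measure_union₀ hm.nullMeasurableSet hd]
  refine measure_mono ?_
  rintro _ (⟨x, ⟨hx, _⟩, rfl⟩ | ⟨y, ⟨hy, _⟩, rfl⟩)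
  · exact h x hx b hb
  · exact h a ha y hy

theorem volume_preimage_div {A : Set ℝ} {a : ℝ} (ha : 0 < a) :
    volume ((fun x => x / a) ⁻¹' A) = ENNReal.ofReal a * volume A := by
  have : (fun x : ℝ => x / a) = fun x => a⁻¹ * x := by
    ext x; field_simp
  rw [this, Real.volume_preimage_mul_left (inv_ne_zero ha.ne'), inv_inv, abs_of_pos ha]

/-- One-dimensional Brunn--Minkowski inequality for convex combinations. -/
theorem mul_volume_add_mul_volume_le {A B C : Set ℝ} (hA : A.Nonempty) (hB : B.Nonempty)
    (hAm : MeasurableSet A) (hBm : MeasurableSet B) {a b : ℝ} (ha : 0 < a) (hb : 0 < b)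
    (h : ∀ x ∈ A, ∀ y ∈ B, a * x + b * y ∈ C) :
    ENNReal.ofReal a * volume A + ENNReal.ofReal b * volume B ≤ volume C := by
  rw [← volume_preimage_div ha, ← volume_preimage_div hb]
  obtain ⟨x, hx⟩ := hA
  obtain ⟨y, hy⟩ := hB
  refine volume_add_volume_le_of_add_mem ⟨a * x, ?_⟩ ⟨b * y, ?_⟩
    (hAm.preimage (measurable_id.div_const _)) (hBm.preimage (measurable_id.div_const _))
    fun u hu v hv => ?_
  · simpa [mul_div_cancel_left₀ x ha.ne'] using hx
  · simpa [mul_div_cancel_left₀ y hb.ne'] using hy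
  · have := h _ hu _ hv
    rwa [mul_div_cancel₀ _ ha.ne', mul_div_cancel₀ _ hb.ne'] at this

/-- Layer-cake formula for functions with values in `[0, 1]`. -/
theorem lintegral_eq_lintegral_Ioo_meas_lt {f : ℝ → ℝ≥0∞} (hf : Measurable f)
    (h1 : ∀ x, f x ≤ 1) :
    ∫⁻ x, f x = ∫⁻ t in Set.Ioo (0 : ℝ) 1, volume {x | ENNReal.ofReal t < f x} := by
  have hfin : ∀ x, f x ≠ ∞ := fun x => ((h1 x).trans_lt ENNReal.one_lt_top).ne
  have e1 : ∫⁻ x, f x = ∫⁻ x, ENNReal.ofReal (f x).toReal :=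
    lintegral_congr fun x => (ENNReal.ofReal_toReal (hfin x)).symm
  rw [e1, lintegral_eq_lintegral_meas_lt volume (ae_of_all _ fun x => ENNReal.toReal_nonneg)
    hf.ennreal_toReal.aemeasurable]
  have e2 : ∀ t ∈ Set.Ioi (0 : ℝ), volume {x | t < (f x).toReal}
      = (Set.Ioo (0 : ℝ) 1).indicator (fun t => volume {x | ENNReal.ofReal t < f x}) t := by
    intro t ht
    have ht' : (0 : ℝ) < t := ht
    by_cases h : t < 1
    · rw [Set.indicator_of_mem (show t ∈ Set.Ioo (0 : ℝ) 1 from ⟨ht, h⟩)]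
      congr 1
      ext x
      exact (ENNReal.ofReal_lt_iff_lt_toReal ht'.le (hfin x)).symm
    · rw [Set.indicator_of_notMem (fun h' => h h'.2)]
      convert measure_empty (μ := volume)
      ext x
      simp only [Set.mem_ofPred_eq, Set.mem_empty_iff_false, iff_false, not_lt]
      refine le_trans ?_ (not_lt.1 h)
      exact ENNReal.toReal_le_of_le_ofReal zero_le_one (by simpa using h1 x)
  rw [setLIntegral_congr_fun measurableSet_Ioi e2, lintegral_indicator measurableSet_Ioo,
    Measure.restrict_restrict measurableSet_Ioo]
  congr 2
  exact Set.inter_eq_left.2 fun t ht => ht.1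

theorem ENNReal_geom_mean_le_arith_mean2 {a b : ℝ} (ha : 0 < a) (hb : 0 < b) (hab : a + b = 1)
    (x y : ℝ≥0∞) :
    x ^ a * y ^ b ≤ ENNReal.ofReal a * x + ENNReal.ofReal b * y := by
  have ha0 : ENNReal.ofReal a ≠ 0 := by simpa using ha
  have hb0 : ENNReal.ofReal b ≠ 0 := by simpa using hb
  by_cases hx : x = ∞
  · simp [hx, ENNReal.mul_top ha0]
  by_cases hy : y = ∞
  · simp [hy, ENNReal.mul_top hb0]
  lift x to ℝ≥0 using hx
  lift y to ℝ≥0 using hy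
  have := NNReal.geom_mean_le_arith_mean2_weighted ⟨a, ha.le⟩ ⟨b, hb.le⟩ x y
    (by ext; exact hab)
  rw [← ENNReal.coe_rpow_of_nonneg _ ha.le, ← ENNReal.coe_rpow_of_nonneg _ hb.le,
    ENNReal.ofReal, ENNReal.ofReal, Real.toNNReal_of_nonneg ha.le, Real.toNNReal_of_nonneg hb.le]
  exact_mod_cast this

/-- One-dimensional Prékopa--Leindler inequality for functions with supremum one. -/
theorem prekopa_leindler_of_iSup_eq_one {f g h : ℝ → ℝ≥0∞} (hf : Measurable f) (hg : Measurable g)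
    (hh : Measurable h) {a b : ℝ} (ha : 0 < a) (hb : 0 < b) (hab : a + b = 1)
    (H : ∀ x y, f x ^ a * g y ^ b ≤ h (a * x + b * y)) (hf1 : ⨆ x, f x = 1) (hg1 : ⨆ x, g x = 1) :
    (∫⁻ x, f x) ^ a * (∫⁻ x, g x) ^ b ≤ ∫⁻ x, h x := by
  -- With both suprema equal to one, even the stronger arithmetic-mean bound holds, and it follows
  -- level by level from Brunn–Minkowski.
  refine (ENNReal_geom_mean_le_arith_mean2 ha hb hab _ _).trans ?_
  have hf1' : ∀ x, f x ≤ 1 := fun x => hf1 ▸ le_iSup f x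
  have hg1' : ∀ x, g x ≤ 1 := fun x => hg1 ▸ le_iSup g x
  have hle : ∫⁻ x, min (h x) 1 ≤ ∫⁻ x, h x := lintegral_mono fun x => min_le_left _ _
  refine le_trans ?_ hle
  rw [lintegral_eq_lintegral_Ioo_meas_lt hf hf1', lintegral_eq_lintegral_Ioo_meas_lt hg hg1',
    lintegral_eq_lintegral_Ioo_meas_lt (hh.min measurable_const) fun x => min_le_right _ _]
  rw [← lintegral_const_mul' _ _ ENNReal.ofReal_ne_top,
    ← lintegral_const_mul' _ _ ENNReal.ofReal_ne_top]
  have hanti : Antitone fun t : ℝ => ENNReal.ofReal a * volume {x | ENNReal.ofReal t < f x} :=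
    fun s t hst => mul_le_mul_right (measure_mono fun x hx =>
      (ENNReal.ofReal_le_ofReal hst).trans_lt hx) _
  rw [← lintegral_add_left hanti.measurable]
  refine setLIntegral_mono' measurableSet_Ioo fun t ht => ?_
  have ht1 : ENNReal.ofReal t < 1 := by simpa using ht.2
  -- Brunn–Minkowski needs nonempty sets; the normalisation of the suprema provides this at every
  -- level below 1.
  have hA : ∃ x, ENNReal.ofReal t < f x := lt_iSup_iff.1 (hf1 ▸ ht1)
  have hB : ∃ x, ENNReal.ofReal t < g x := lt_iSup_iff.1 (hg1 ▸ ht1)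
  refine mul_volume_add_mul_volume_le hA hB (measurableSet_lt measurable_const hf)
    (measurableSet_lt measurable_const hg) ha hb fun x hx y hy => ?_
  refine lt_min (lt_of_lt_of_le ?_ (H x y)) ht1
  have e : ENNReal.ofReal t = ENNReal.ofReal t ^ a * ENNReal.ofReal t ^ b := by
    rw [← ENNReal.rpow_add _ _ (by simpa using ht.1) ENNReal.ofReal_ne_top, hab, ENNReal.rpow_one]
  rw [e]
  exact ENNReal.mul_lt_mul (ENNReal.rpow_lt_rpow hx ha) (ENNReal.rpow_lt_rpow hy hb)

/-- One-dimensional Prékopa--Leindler inequality for bounded functions. -/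
theorem prekopa_leindler_of_le {f g h : ℝ → ℝ≥0∞} (hf : Measurable f) (hg : Measurable g)
    (hh : Measurable h) {a b : ℝ} (ha : 0 < a) (hb : 0 < b) (hab : a + b = 1)
    (H : ∀ x y, f x ^ a * g y ^ b ≤ h (a * x + b * y)) {N : ℝ≥0∞} (hN : N ≠ ∞)
    (hfN : ∀ x, f x ≤ N) (hgN : ∀ x, g x ≤ N) :
    (∫⁻ x, f x) ^ a * (∫⁻ x, g x) ^ b ≤ ∫⁻ x, h x := by
  set A := ⨆ x, f x with hA
  set B := ⨆ x, g x with hB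
  have hAt : A ≠ ∞ := ((iSup_le hfN).trans_lt hN.lt_top).ne
  have hBt : B ≠ ∞ := ((iSup_le hgN).trans_lt hN.lt_top).ne
  by_cases hA0 : A = 0
  · have : ∀ x, f x = 0 := by simpa [hA] using hA0
    simp [this, ha]
  by_cases hB0 : B = 0
  · have : ∀ x, g x = 0 := by simpa [hB] using hB0
    simp [this, hb]
  have hAi : A⁻¹ ≠ ∞ := by simpa using hA0
  have hBi : B⁻¹ ≠ ∞ := by simpa using hB0
  have key := prekopa_leindler_of_iSup_eq_one (f := fun x => A⁻¹ * f x) (g := fun x => B⁻¹ * g x)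
    (h := fun x => (A⁻¹ ^ a * B⁻¹ ^ b) * h x) (hf.const_mul _) (hg.const_mul _) (hh.const_mul _)
    ha hb hab (fun x y => by
      rw [ENNReal.mul_rpow_of_nonneg _ _ ha.le, ENNReal.mul_rpow_of_nonneg _ _ hb.le,
        mul_mul_mul_comm]
      gcongr
      exact H x y)
    (by rw [← ENNReal.mul_iSup, ENNReal.inv_mul_cancel hA0 hAt])
    (by rw [← ENNReal.mul_iSup, ENNReal.inv_mul_cancel hB0 hBt])
  rw [lintegral_const_mul _ hf, lintegral_const_mul _ hg, lintegral_const_mul _ hh,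
    ENNReal.mul_rpow_of_nonneg _ _ ha.le, ENNReal.mul_rpow_of_nonneg _ _ hb.le,
    mul_mul_mul_comm] at key
  refine (ENNReal.mul_le_mul_iff_right ?_ ?_).1 key
  · refine mul_ne_zero ?_ ?_
    · simp [ENNReal.rpow_eq_zero_iff, hAt, ha, hA0]
    · simp [ENNReal.rpow_eq_zero_iff, hBt, hb, hB0]
  · exact ENNReal.mul_ne_top (ENNReal.rpow_ne_top_of_nonneg ha.le hAi)
      (ENNReal.rpow_ne_top_of_nonneg hb.le hBi)

theorem iSup_lintegral_min_natCast {f : ℝ → ℝ≥0∞} (hf : Measurable f) :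
    ⨆ n : ℕ, ∫⁻ x, min (f x) n = ∫⁻ x, f x := by
  rw [← lintegral_iSup (fun n => hf.min measurable_const)
    (fun m n hmn x => min_le_min_left _ (by exact_mod_cast hmn))]
  refine lintegral_congr fun x => ?_
  change ⨆ n : ℕ, f x ⊓ (n : ℝ≥0∞) = f x
  rw [← inf_iSup_eq, ENNReal.iSup_natCast, inf_top_eq]

/-- One-dimensional Prékopa--Leindler inequality. -/
theorem prekopa_leindler {f g h : ℝ → ℝ≥0∞} (hf : Measurable f) (hg : Measurable g)
    (hh : Measurable h) {a b : ℝ} (ha : 0 < a) (hb : 0 < b) (hab : a + b = 1)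
    (H : ∀ x y, f x ^ a * g y ^ b ≤ h (a * x + b * y)) :
    (∫⁻ x, f x) ^ a * (∫⁻ x, g x) ^ b ≤ ∫⁻ x, h x := by
  have tend : ∀ {u : ℝ → ℝ≥0∞}, Measurable u →
      Filter.Tendsto (fun n : ℕ => ∫⁻ x, min (u x) n) Filter.atTop (nhds (∫⁻ x, u x)) := by
    intro u hu
    rw [← iSup_lintegral_min_natCast hu]
    exact tendsto_atTop_iSup fun m n hmn => lintegral_mono fun x =>
      min_le_min_left _ (by exact_mod_cast hmn)
  have bound : ∀ n m : ℕ, (∫⁻ x, min (f x) n) ^ a * (∫⁻ x, min (g x) m) ^ b ≤ ∫⁻ x, h x := by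
    intro n m
    refine prekopa_leindler_of_le (hf.min measurable_const) (hg.min measurable_const) hh ha hb hab
      (fun x y => le_trans ?_ (H x y)) (N := max n m) (by simp)
      (fun x => (min_le_right _ _).trans (le_max_left _ _))
      (fun x => (min_le_right _ _).trans (le_max_right _ _))
    gcongr <;> exact min_le_left _ _
  by_cases hf0 : ∫⁻ x, f x = 0
  · simp [hf0, ha]
  by_cases hg0 : ∫⁻ x, g x = 0
  · simp [hg0, hb]
  refine le_of_tendsto' (ENNReal.Tendsto.mul ((ENNReal.continuous_rpow_const.tendsto _).comp
    (tend hf)) (Or.inl ?_) ((ENNReal.continuous_rpow_const.tendsto _).comp (tend hg)) (Or.inl ?_))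
    fun n => bound n n
  · simp [ENNReal.rpow_eq_zero_iff, ha, hf0, ha.not_gt]
  · simp [ENNReal.rpow_eq_zero_iff, hb, hg0, hb.not_gt]

/-! ### Marginals of log-concave functions. -/

/-- Log-concavity of a function with values in `[0, ∞]`. -/
def LogConcave {E : Type*} [AddCommMonoid E] [Module ℝ E] (f : E → ℝ≥0∞) : Prop :=
  ∀ x y : E, ∀ a b : ℝ, 0 < a → 0 < b → a + b = 1 → f x ^ a * f y ^ b ≤ f (a • x + b • y)

section Marginal

variable {ι : Type*} [DecidableEq ι] {f : (ι → ℝ) → ℝ≥0∞}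

/-- Prékopa's theorem: marginals of log-concave functions are log-concave. -/
theorem LogConcave.lmarginal (hfm : Measurable f) (hf : LogConcave f) (s : Finset ι) :
    LogConcave (∫⋯∫⁻_s, f ∂fun _ => volume) := by
  induction s using Finset.induction with
  | empty => simpa using hf
  | insert i s hi ih =>
    intro x y a b ha hb hab
    have hm : Measurable (∫⋯∫⁻_s, f ∂fun _ => (volume : Measure ℝ)) := hfm.lmarginal _
    rw [lmarginal_insert _ hfm hi, lmarginal_insert _ hfm hi, lmarginal_insert _ hfm hi]
    refine prekopa_leindler (hm.comp (measurable_update _)) (hm.comp (measurable_update _))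
      (hm.comp (measurable_update _)) ha hb hab fun u v => ?_
    -- Convex combinations act coordinatewise, so the inductive hypothesis is exactly the
    -- Prékopa–Leindler condition in the variable `i`.
    have e : Function.update (a • x + b • y) i (a * u + b * v)
        = a • Function.update x i u + b • Function.update y i v := by
      ext j
      by_cases hj : j = i
      · subst hj; simp
      · simp [hj]
    simp only [Function.comp_apply]
    rw [e]
    exact ih _ _ a b ha hb hab

variable [Fintype ι]

/-- The density of the `i`-th coordinate. -/
noncomputable def coordMarginal (f : (ι → ℝ) → ℝ≥0∞) (i : ι) (t : ℝ) : ℝ≥0∞ :=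
  (∫⋯∫⁻_(Finset.univ.erase i), f ∂fun _ => volume) (Function.update 0 i t)

theorem measurable_coordMarginal (hfm : Measurable f) (i : ι) :
    Measurable (coordMarginal f i) :=
  (hfm.lmarginal _).comp (measurable_update _)

theorem LogConcave.coordMarginal (hfm : Measurable f) (hf : LogConcave f) (i : ι) :
    LogConcave (coordMarginal f i) := by
  intro u v a b ha hb hab
  have e : Function.update (0 : ι → ℝ) i (a • u + b • v)
      = a • Function.update (0 : ι → ℝ) i u + b • Function.update (0 : ι → ℝ) i v := by
    ext j
    by_cases hj : j = i
    · subst hj; simp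
    · simp [hj]
  unfold LogConcaveSampling.coordMarginal
  rw [e]
  exact hf.lmarginal hfm _ _ _ a b ha hb hab

theorem lintegral_mul_coordMarginal (hfm : Measurable f) (i : ι) {F : ℝ → ℝ≥0∞}
    (hF : Measurable F) :
    ∫⁻ x : ι → ℝ, F (x i) * f x = ∫⁻ t, F t * coordMarginal f i t := by
  rw [volume_pi, lintegral_eq_lmarginal_univ (0 : ι → ℝ),
    lmarginal_erase (fun x => F (x i) * f x)
      ((hF.comp (measurable_pi_apply i)).mul hfm) (Finset.mem_univ i)]
  refine lintegral_congr fun t => ?_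
  unfold coordMarginal MeasureTheory.lmarginal
  have hm : Measurable fun y : ({ x // x ∈ Finset.univ.erase i } → ℝ) =>
      f (Function.updateFinset (Function.update 0 i t) (Finset.univ.erase i) y) :=
    hfm.comp measurable_updateFinset
  rw [← lintegral_const_mul _ hm]
  refine lintegral_congr fun y => ?_
  simp [Function.updateFinset_def]

end Marginal

/-! ### Comparison with an exponential density on the half-line. -/

/-- In the variable y = x² the power x^k is the convex function y^{k/2}. The line A y - B is its
chord through a² and b², above the graph between these points and below it outside. -/
theorem exists_chord {k : ℝ} (hk : 2 ≤ k) {a b : ℝ} (ha : 0 ≤ a) (hab : a < b) :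
    ∃ A B : ℝ, 0 ≤ A ∧ 0 ≤ B ∧ (∀ x, a ≤ x → x ≤ b → x ^ k + B ≤ A * x ^ 2) ∧
      ∀ x, 0 ≤ x → (x ≤ a ∨ b ≤ x) → A * x ^ 2 ≤ x ^ k + B := by
  have hr : (1 : ℝ) ≤ k / 2 := by linarith
  have hc := convexOn_rpow hr
  have hsq : ∀ x : ℝ, 0 ≤ x → (x ^ 2) ^ (k / 2) = x ^ k := fun x hx => by
    rw [← Real.rpow_natCast, ← Real.rpow_mul hx]; congr 1; push_cast; ring
  have hab2 : a ^ 2 < b ^ 2 := by gcongr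
  have hpos : 0 < b ^ 2 - a ^ 2 := by linarith
  set A := (b ^ k - a ^ k) / (b ^ 2 - a ^ 2) with hA
  have hA0 : 0 ≤ A := by
    have : a ^ k ≤ b ^ k := Real.rpow_le_rpow ha hab.le (by linarith)
    exact div_nonneg (by linarith) hpos.le
  have hb0 : 0 ≤ b := ha.trans hab.le
  have sec : ∀ x y : ℝ, 0 ≤ x → 0 ≤ y → x ≠ a → y ≠ a → x ≤ y →
      (x ^ k - a ^ k) / (x ^ 2 - a ^ 2) ≤ (y ^ k - a ^ k) / (y ^ 2 - a ^ 2) := by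
    intro x y hx hy hxa hya hxy
    have := hc.secant_mono (a := a ^ 2) (x := x ^ 2) (y := y ^ 2) (sq_nonneg a) (sq_nonneg x)
      (sq_nonneg y) (fun h => hxa ((sq_eq_sq₀ hx ha).1 h)) (fun h => hya ((sq_eq_sq₀ hy ha).1 h))
      (by gcongr)
    rwa [hsq x hx, hsq y hy, hsq a ha] at this
  have out : ∀ x, 0 ≤ x → (x ≤ a ∨ b ≤ x) → A * x ^ 2 ≤ x ^ k + (A * a ^ 2 - a ^ k) := by
    intro x hx h
    rcases h with h | h
    · rcases h.eq_or_lt with rfl | h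
      · linarith
      · have h1 := sec x b hx hb0 h.ne hab.ne' (h.trans hab).le
        have h2 : x ^ 2 - a ^ 2 < 0 := by
          have : x ^ 2 < a ^ 2 := by gcongr
          linarith
        rw [div_le_iff_of_neg h2] at h1
        linarith
    · have h1 := sec b x hb0 hx hab.ne' (hab.trans_le h).ne' h
      have h2 : 0 < x ^ 2 - a ^ 2 := by
        have : a ^ 2 < x ^ 2 := by
          have := hab.trans_le h
          gcongr
        linarith
      rw [le_div_iff₀ h2] at h1
      linarith
  refine ⟨A, A * a ^ 2 - a ^ k, hA0, ?_, ?_, out⟩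
  · have := out 0 le_rfl (Or.inl ha)
    rw [Real.zero_rpow (by linarith)] at this
    linarith
  · intro x h1 h2
    rcases h1.eq_or_lt with rfl | h1
    · linarith
    · have h3 := sec x b (ha.trans h1.le) hb0 h1.ne' hab.ne' h2
      have h4 : 0 < x ^ 2 - a ^ 2 := by
        have : a ^ 2 < x ^ 2 := by gcongr
        linarith
      rw [div_le_iff₀ h4] at h3
      linarith

theorem ENNReal_rearrangement {a b c d : ℝ≥0∞} (hab : a ≤ b) (hcd : c ≤ d) :
    a * d + b * c ≤ a * c + b * d := by
  obtain ⟨u, rfl⟩ := exists_add_of_le hab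
  obtain ⟨v, rfl⟩ := exists_add_of_le hcd
  calc a * (c + v) + (a + u) * c = a * c + (a * v + a * c + u * c) := by ring
    _ ≤ a * c + (a * v + a * c + u * c) + u * v := le_self_add
    _ = a * c + (a + u) * (c + v) := by ring

/-- This is ∫ (P - Q)(h - e) ≤ 0 for factors of opposite sign, written without subtraction so that
it makes sense in [0, ∞]. -/
theorem lintegral_mul_add_le_of_antivary {μ : Measure ℝ} {P Q e h : ℝ → ℝ≥0∞} (hP : Measurable P)
    (he : Measurable e) (hh : Measurable h)
    (H : ∀ᵐ x ∂μ, (e x ≤ h x ∧ P x ≤ Q x) ∨ (h x ≤ e x ∧ Q x ≤ P x)) :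
    ∫⁻ x, P x * h x ∂μ + ∫⁻ x, Q x * e x ∂μ ≤ ∫⁻ x, P x * e x ∂μ + ∫⁻ x, Q x * h x ∂μ := by
  rw [← lintegral_add_left (by fun_prop), ← lintegral_add_left (by fun_prop)]
  refine lintegral_mono_ae (H.mono fun x hx => ?_)
  rcases hx with ⟨h1, h2⟩ | ⟨h1, h2⟩
  · exact ENNReal_rearrangement h2 h1
  · rw [add_comm, add_comm (P x * e x)]
    exact ENNReal_rearrangement h2 h1

theorem rpow_mul_rpow_exp {c l a b x y : ℝ} (hc : 0 < c) (hab : a + b = 1) :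
    ENNReal.ofReal (c * Real.exp (-(l * x))) ^ a * ENNReal.ofReal (c * Real.exp (-(l * y))) ^ b
      = ENNReal.ofReal (c * Real.exp (-(l * (a * x + b * y)))) := by
  have h : ∀ z, 0 < c * Real.exp (-(l * z)) := fun z => by positivity
  rw [ENNReal.ofReal_rpow_of_pos (h x), ENNReal.ofReal_rpow_of_pos (h y),
    ← ENNReal.ofReal_mul (by positivity)]
  congr 1
  rw [Real.mul_rpow hc.le (Real.exp_pos _).le, Real.mul_rpow hc.le (Real.exp_pos _).le,
    mul_mul_mul_comm, ← Real.rpow_add hc, hab, Real.rpow_one, ← Real.exp_mul, ← Real.exp_mul,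
    ← Real.exp_add]
  ring_nf

/-- Among log-concave functions on the half-line with given mass and smaller second moment,
the exponential density has the largest moments of higher order. -/
theorem LogConcave.lintegral_rpow_le_exp {h : ℝ → ℝ≥0∞} (hm : Measurable h) (hlc : LogConcave h)
    {k : ℝ} (hk : 2 ≤ k) {c l : ℝ} (hc : 0 < c)
    (hW : ∫⁻ x in Set.Ioi 0, h x
      = ∫⁻ x in Set.Ioi 0, ENNReal.ofReal (c * Real.exp (-(l * x))))
    (hWfin : ∫⁻ x in Set.Ioi 0, h x ≠ ∞)
    (hM : ∫⁻ x in Set.Ioi 0, ENNReal.ofReal x ^ 2 * h x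
      < ∫⁻ x in Set.Ioi 0, ENNReal.ofReal x ^ 2 * ENNReal.ofReal (c * Real.exp (-(l * x)))) :
    ∫⁻ x in Set.Ioi 0, ENNReal.ofReal x ^ k * h x
      ≤ ∫⁻ x in Set.Ioi 0, ENNReal.ofReal x ^ k * ENNReal.ofReal (c * Real.exp (-(l * x))) := by
  set e : ℝ → ℝ≥0∞ := fun x => ENNReal.ofReal (c * Real.exp (-(l * x))) with he
  have hem : Measurable e := by fun_prop
  set S : Set ℝ := {x | 0 < x ∧ e x ≤ h x} with hS
  -- `S` is an interval because `h` is log-concave while log `e` is affine.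
  have hconn : ∀ x ∈ S, ∀ y ∈ S, ∀ z, x ≤ z → z ≤ y → z ∈ S := by
    intro x hx y hy z hxz hzy
    rcases hxz.eq_or_lt with rfl | hxz
    · exact hx
    rcases hzy.eq_or_lt with rfl | hzy
    · exact hy
    refine ⟨hx.1.trans hxz, ?_⟩
    have hyx : 0 < y - x := by linarith
    have ha : 0 < (y - z) / (y - x) := div_pos (by linarith) hyx
    have hb : 0 < (z - x) / (y - x) := div_pos (by linarith) hyx
    have hab : (y - z) / (y - x) + (z - x) / (y - x) = 1 := by field_simp; ring
    have hz : (y - z) / (y - x) * x + (z - x) / (y - x) * y = z := by field_simp; ring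
    have h1 := rpow_mul_rpow_exp (l := l) (x := x) (y := y) hc hab
    have h2 := hlc x y _ _ ha hb hab
    rw [smul_eq_mul, smul_eq_mul, hz] at h2
    rw [hz] at h1
    refine le_trans ?_ h2
    change ENNReal.ofReal (c * Real.exp (-(l * z))) ≤ _
    rw [← h1]
    gcongr
    · exact hx.2
    · exact hy.2
  have hne : ∀ᵐ x : ℝ ∂volume.restrict (Set.Ioi 0), x ≠ sInf S ∧ x ∈ Set.Ioi (0 : ℝ) := by
    refine Filter.Eventually.and (ae_restrict_of_ae ?_) (ae_restrict_mem measurableSet_Ioi)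
    exact Measure.ae_ne volume (sInf S)
  by_cases hsub : S.Subsingleton
  · refine lintegral_mono_ae ?_
    have hSn : ∀ᵐ x : ℝ ∂volume.restrict (Set.Ioi 0), x ∉ S :=
      ae_restrict_of_ae (measure_eq_zero_iff_ae_notMem.1 (hsub.measure_zero volume))
    filter_upwards [hSn, ae_restrict_mem measurableSet_Ioi] with x hx hx0
    have : h x ≤ e x := by
      by_contra hcon
      exact hx ⟨hx0, (not_le.1 hcon).le⟩
    gcongr
  rw [Set.not_subsingleton_iff] at hsub
  obtain ⟨u, hu, v, hv, huv⟩ := hsub.exists_lt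
  have hbb : BddBelow S := ⟨0, fun x hx => hx.1.le⟩
  have ha0 : 0 ≤ sInf S := le_csInf ⟨u, hu⟩ fun x hx => hx.1.le
  have hlow : ∀ x, x < sInf S → x ∉ S := fun x hx hxS => (csInf_le hbb hxS).not_gt hx
  by_cases hbdd : BddAbove S
  · have hab : sInf S < sSup S := (csInf_le hbb hu).trans_lt (huv.trans_le (le_csSup hbdd hv))
    obtain ⟨A, B, hA, hB, hin, hout⟩ := exists_chord hk ha0 hab
    -- The chord through the endpoints of `S` makes x^k + B - A x² change sign oppositely to h - e.
    -- The masses agree, so `B` drops out, and the k-th moments are ordered like the second moments.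
    have key := lintegral_mul_add_le_of_antivary (μ := volume.restrict (Set.Ioi 0))
      (P := fun x => ENNReal.ofReal x ^ k + ENNReal.ofReal B)
      (Q := fun x => ENNReal.ofReal A * ENNReal.ofReal x ^ 2) (by fun_prop) hem hm (by
        filter_upwards [ae_restrict_mem measurableSet_Ioi] with x hx
        have hx0 : (0 : ℝ) < x := hx
        rw [ENNReal.ofReal_rpow_of_pos hx0, ← ENNReal.ofReal_pow hx0.le,
          ← ENNReal.ofReal_mul hA, ← ENNReal.ofReal_add (by positivity) hB]
        by_cases hxS : x ∈ S
        · exact Or.inl ⟨hxS.2, ENNReal.ofReal_le_ofReal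
            (hin x (csInf_le hbb hxS) (le_csSup hbdd hxS))⟩
        · refine Or.inr ⟨?_, ENNReal.ofReal_le_ofReal (hout x hx0.le ?_)⟩
          · by_contra hcon
            exact hxS ⟨hx0, (not_le.1 hcon).le⟩
          · by_contra! hcon
            obtain ⟨s, hs, hsx⟩ := exists_lt_of_csInf_lt ⟨u, hu⟩ hcon.1
            obtain ⟨t, ht, htx⟩ := exists_lt_of_lt_csSup ⟨u, hu⟩ hcon.2
            exact hxS (hconn s hs t ht x hsx.le htx.le))
    have split : ∀ g : ℝ → ℝ≥0∞, Measurable g →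
        ∫⁻ x in Set.Ioi 0, (ENNReal.ofReal x ^ k + ENNReal.ofReal B) * g x
          = (∫⁻ x in Set.Ioi 0, ENNReal.ofReal x ^ k * g x)
            + ENNReal.ofReal B * ∫⁻ x in Set.Ioi 0, g x := by
      intro g hg
      rw [← lintegral_const_mul _ hg, ← lintegral_add_left (by fun_prop)]
      simp only [add_mul]
    have mulA : ∀ g : ℝ → ℝ≥0∞, Measurable g →
        ∫⁻ x in Set.Ioi 0, ENNReal.ofReal A * ENNReal.ofReal x ^ 2 * g x
          = ENNReal.ofReal A * ∫⁻ x in Set.Ioi 0, ENNReal.ofReal x ^ 2 * g x := by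
      intro g hg
      rw [← lintegral_const_mul _ (by fun_prop)]
      simp_rw [mul_assoc]
    rw [split h hm, split e hem, mulA h hm, mulA e hem, ← hW, add_assoc, add_assoc] at key
    have hfin : ENNReal.ofReal B * (∫⁻ x in Set.Ioi 0, h x)
        + ENNReal.ofReal A * ∫⁻ x in Set.Ioi 0, ENNReal.ofReal x ^ 2 * h x ≠ ∞ :=
      ENNReal.add_ne_top.2 ⟨ENNReal.mul_ne_top ENNReal.ofReal_ne_top hWfin,
        ENNReal.mul_ne_top ENNReal.ofReal_ne_top hM.ne_top⟩
    refine (ENNReal.add_le_add_iff_right hfin).1 (le_trans ?_ key)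
    gcongr
  · exfalso
    -- If `S` were unbounded, h - e would change sign only once, from negative to positive; equal
    -- masses would then give `h` the larger second moment, against the strict inequality `hM`.
    have hup : ∀ x, sInf S < x → x ∈ S := by
      intro x hx
      obtain ⟨s, hs, hsx⟩ := exists_lt_of_csInf_lt ⟨u, hu⟩ hx
      obtain ⟨t, ht, htx⟩ := not_bddAbove_iff.1 hbdd x
      exact hconn s hs t ht x hsx.le htx.le
    have key := lintegral_mul_add_le_of_antivary (μ := volume.restrict (Set.Ioi 0))
      (P := fun x => ENNReal.ofReal (sInf S) ^ 2)
      (Q := fun x => ENNReal.ofReal x ^ 2) (by fun_prop) hem hm (by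
        filter_upwards [hne] with x hx
        rcases lt_or_gt_of_ne hx.1 with hx1 | hx1
        · refine Or.inr ⟨?_, by gcongr⟩
          by_contra hcon
          exact hlow x hx1 ⟨hx.2, (not_le.1 hcon).le⟩
        · exact Or.inl ⟨(hup x hx1).2, by gcongr⟩)
    rw [lintegral_const_mul _ hm, lintegral_const_mul _ hem, ← hW] at key
    have hfin : ENNReal.ofReal (sInf S) ^ 2 * ∫⁻ x in Set.Ioi 0, h x ≠ ∞ :=
      ENNReal.mul_ne_top (by simp) hWfin
    exact hM.not_ge ((ENNReal.add_le_add_iff_left hfin).1 key)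

theorem lintegral_rpow_mul_exp {s c l : ℝ} (hs : -1 < s) (hc : 0 ≤ c) (hl : 0 < l) :
    ∫⁻ x in Set.Ioi (0 : ℝ), ENNReal.ofReal x ^ s * ENNReal.ofReal (c * Real.exp (-(l * x)))
      = ENNReal.ofReal (c * (Real.Gamma (s + 1) * l⁻¹ ^ (s + 1))) := by
  have h1 := Real.integral_rpow_mul_exp_neg_mul_Ioi (a := s + 1) (r := l) (by linarith) hl
  have hpos : 0 < Real.Gamma (s + 1) := Real.Gamma_pos_of_pos (by linarith)
  have hint : IntegrableOn (fun x : ℝ => x ^ (s + 1 - 1) * Real.exp (-(l * x))) (Set.Ioi 0) := by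
    -- The Bochner integral of a non-integrable function is 0, whereas the formula gives a positive
    -- value.
    by_contra hcon
    rw [integral_undef hcon] at h1
    have : 0 < (1 / l) ^ (s + 1) * Real.Gamma (s + 1) := by positivity
    linarith
  have e : ∀ x ∈ Set.Ioi (0 : ℝ),
      ENNReal.ofReal x ^ s * ENNReal.ofReal (c * Real.exp (-(l * x)))
        = ENNReal.ofReal c * ENNReal.ofReal (x ^ (s + 1 - 1) * Real.exp (-(l * x))) := by
    intro x hx
    have hx0 : (0 : ℝ) < x := hx
    rw [ENNReal.ofReal_rpow_of_pos hx0, ← ENNReal.ofReal_mul (by positivity),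
      ← ENNReal.ofReal_mul hc, add_sub_cancel_right]
    ring_nf
  rw [setLIntegral_congr_fun measurableSet_Ioi e, lintegral_const_mul' _ _ ENNReal.ofReal_ne_top,
    ← ofReal_integral_eq_lintegral_ofReal hint, h1, ← ENNReal.ofReal_mul hc, one_div,
    mul_comm (Real.Gamma _)]
  filter_upwards [ae_restrict_mem measurableSet_Ioi] with x hx
  have hx0 : (0 : ℝ) < x := hx
  positivity

/-- Moment comparison on the half-line for log-concave functions of mass in `[1/2, 1]`. -/
theorem LogConcave.lintegral_Ioi_rpow_le {h : ℝ → ℝ≥0∞} (hm : Measurable h) (hlc : LogConcave h)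
    {k : ℝ} (hk : 2 ≤ k) (hW1 : 1 / 2 ≤ ∫⁻ x in Set.Ioi 0, h x)
    (hW2 : ∫⁻ x in Set.Ioi 0, h x ≤ 1) :
    ∫⁻ x in Set.Ioi 0, ENNReal.ofReal x ^ k * h x
      ≤ ENNReal.ofReal (Real.Gamma (k + 1) / 2)
        * (∫⁻ x in Set.Ioi 0, ENNReal.ofReal x ^ 2 * h x) ^ (k / 2) := by
  have hk0 : 0 < k := by linarith
  have hG : 0 < Real.Gamma (k + 1) := Real.Gamma_pos_of_pos (by linarith)
  obtain ⟨w, hw, hw0⟩ : ∃ w : ℝ, ∫⁻ x in Set.Ioi 0, h x = ENNReal.ofReal w ∧ 0 ≤ w :=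
    ⟨_, (ENNReal.ofReal_toReal (hW2.trans_lt ENNReal.one_lt_top).ne).symm, ENNReal.toReal_nonneg⟩
  have hw1 : 1 / 2 ≤ w := by
    rw [hw, show (1 / 2 : ℝ≥0∞) = ENNReal.ofReal (1 / 2) by
      rw [ENNReal.ofReal_div_of_pos (by norm_num)]; simp] at hW1
    exact (ENNReal.ofReal_le_ofReal_iff hw0).1 hW1
  by_cases hMt : ∫⁻ x in Set.Ioi 0, ENNReal.ofReal x ^ 2 * h x = ∞
  · rw [hMt, ENNReal.top_rpow_of_pos (by linarith), ENNReal.mul_top (by simpa using hG)]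
    exact le_top
  obtain ⟨M, hM, hM0⟩ : ∃ M : ℝ, ∫⁻ x in Set.Ioi 0, ENNReal.ofReal x ^ 2 * h x
      = ENNReal.ofReal M ∧ 0 ≤ M :=
    ⟨_, (ENNReal.ofReal_toReal hMt).symm, ENNReal.toReal_nonneg⟩
  -- The competitor (w/t)e^{-x/t} has mass w, second moment 2wt² and k-th moment wΓ(k+1)t^k.
  have step : ∀ t : ℝ, 0 < t → M < 2 * w * t ^ 2 →
      ∫⁻ x in Set.Ioi 0, ENNReal.ofReal x ^ k * h x
        ≤ ENNReal.ofReal (w * (Real.Gamma (k + 1) * t ^ k)) := by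
    intro t ht htM
    have hl : 0 < t⁻¹ := inv_pos.2 ht
    have hc : 0 < w * t⁻¹ := by positivity
    have e0 := lintegral_rpow_mul_exp (s := 0) (by norm_num) hc.le hl
    have e2 := lintegral_rpow_mul_exp (s := 2) (by norm_num) hc.le hl
    have ek := lintegral_rpow_mul_exp (s := k) (by linarith) hc.le hl
    simp only [ENNReal.rpow_zero, one_mul, zero_add, Real.Gamma_one, inv_inv, Real.rpow_one] at e0
    rw [inv_inv, Real.rpow_add_one ht.ne'] at e2 ek
    have g3 : Real.Gamma (2 + 1) = 2 := by
      rw [Real.Gamma_add_one (by norm_num), Real.Gamma_two, mul_one]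
    rw [g3, Real.rpow_two] at e2
    simp only [ENNReal.rpow_two] at e2
    have r0 : w * t⁻¹ * t = w := by field_simp
    have r2 : w * t⁻¹ * (2 * (t ^ 2 * t)) = 2 * w * t ^ 2 := by field_simp
    have rk : w * t⁻¹ * (Real.Gamma (k + 1) * (t ^ k * t)) = w * (Real.Gamma (k + 1) * t ^ k) := by
      field_simp
    rw [r0] at e0
    rw [r2] at e2
    rw [rk] at ek
    rw [← ek]
    refine hlc.lintegral_rpow_le_exp hm hk hc (hw.trans e0.symm) (by simp [hw]) ?_
    rw [e2, hM]
    exact (ENNReal.ofReal_lt_ofReal_iff_of_nonneg hM0).2 htM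
  -- At t₀ the second moments coincide. The comparison needs a strict inequality, so t₀ is
  -- approached from the right, which also covers M = 0.
  set t₀ := Real.sqrt (M / (2 * w)) with ht₀
  have hcont : Continuous fun t : ℝ => ENNReal.ofReal (w * (Real.Gamma (k + 1) * t ^ k)) :=
    ENNReal.continuous_ofReal.comp (continuous_const.mul (continuous_const.mul
      (Real.continuous_rpow_const hk0.le)))
  have lim : ∫⁻ x in Set.Ioi 0, ENNReal.ofReal x ^ k * h x
      ≤ ENNReal.ofReal (w * (Real.Gamma (k + 1) * t₀ ^ k)) := by
    refine ge_of_tendsto (hcont.continuousWithinAt (s := Set.Ioi t₀)) ?_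
    filter_upwards [self_mem_nhdsWithin] with t ht
    have ht' : t₀ < t := ht
    have h0 : 0 ≤ t₀ := Real.sqrt_nonneg _
    refine step t (h0.trans_lt ht') ?_
    have : M / (2 * w) < t ^ 2 := (Real.sqrt_lt' (h0.trans_lt ht')).1 ht'
    rw [div_lt_iff₀ (by linarith)] at this
    linarith
  refine lim.trans ?_
  rw [hM, ENNReal.ofReal_rpow_of_nonneg hM0 (by linarith), ← ENNReal.ofReal_mul (by positivity)]
  refine ENNReal.ofReal_le_ofReal ?_
  have h2w : 1 ≤ 2 * w := by linarith
  have e1 : t₀ ^ k = M ^ (k / 2) / (2 * w) ^ (k / 2) := by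
    rw [ht₀, Real.sqrt_eq_rpow, ← Real.rpow_mul (by positivity), one_div_mul_eq_div,
      Real.div_rpow hM0 (by linarith)]
  -- Mass at least 1/2 enters here: it absorbs w/(2w)^{k/2} into 1/2.
  have e2 : 2 * w ≤ (2 * w) ^ (k / 2) := by
    simpa using Real.rpow_le_rpow_of_exponent_le h2w (show 1 ≤ k / 2 by linarith)
  rw [e1, ← mul_div_assoc, ← mul_div_assoc, div_le_iff₀ (by positivity)]
  have hMk : 0 ≤ M ^ (k / 2) := Real.rpow_nonneg hM0 _
  nlinarith [mul_nonneg hG.le hMk]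

/-! ### Moments on the whole line, by a shift to the median. -/

theorem exists_lintegral_Ioi_eq_half {g : ℝ → ℝ≥0∞} (hm : Measurable g) (h1 : ∫⁻ x, g x = 1)
    (h0 : ∫⁻ x in Set.Ioi 0, g x ≤ 1 / 2) :
    ∃ s : ℝ, 0 ≤ s ∧ ∫⁻ x in Set.Ioi (-s), g x = 1 / 2 := by
  have hint : Integrable (fun x => (g x).toReal) :=
    integrable_toReal_of_lintegral_ne_top hm.aemeasurable (by simp [h1])
  have hfin : ∀ᵐ x, g x < ∞ := ae_lt_top hm (by simp [h1])
  have hreal : ∀ t : ℝ, (∫ x in Set.Ioi t, (g x).toReal) = (∫⁻ x in Set.Ioi t, g x).toReal :=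
    fun t => integral_toReal hm.aemeasurable (ae_restrict_of_ae hfin)
  have hle : ∀ t : ℝ, ∫⁻ x in Set.Ioi t, g x ≤ 1 := fun t => h1 ▸ setLIntegral_le_lintegral _ _
  have hcont : Continuous fun t : ℝ => ∫ x in Set.Ioi t, (g x).toReal := by
    have : (fun t : ℝ => ∫ x in Set.Ioi t, (g x).toReal)
        = fun t => (∫ x in Set.Ioi 0, (g x).toReal) - ∫ x in (0 : ℝ)..t, (g x).toReal := by
      ext t
      rw [← intervalIntegral.integral_interval_add_Ioi (a := 0) (b := t) hint.integrableOn
        hint.integrableOn]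
      ring
    rw [this]
    exact continuous_const.sub (hint.continuous_primitive 0)
  obtain ⟨n, hn⟩ : ∃ n : ℕ, 1 / 2 < ∫⁻ x in Set.Ioi (-(n : ℝ)), g x := by
    by_contra! hcon
    have hU : (⋃ n : ℕ, Set.Ioi (-(n : ℝ))) = Set.univ := by
      ext x
      obtain ⟨n, hn⟩ := exists_nat_gt (-x)
      simp only [Set.mem_iUnion, Set.mem_Ioi, Set.mem_univ, iff_true]
      exact ⟨n, by linarith⟩
    have hmono : Monotone fun n : ℕ => Set.Ioi (-(n : ℝ)) := fun m n hmn =>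
      Set.Ioi_subset_Ioi (by simpa using hmn)
    have := setLIntegral_iUnion_of_directed (μ := volume) g hmono.directed_le
    rw [hU, setLIntegral_univ, h1] at this
    have h2 : (1 : ℝ≥0∞) ≤ 1 / 2 := this.le.trans (iSup_le hcon)
    exact absurd h2 (by
      rw [not_le]
      exact ENNReal.div_lt_of_lt_mul (by norm_num))
  have hhalf : ((1 / 2 : ℝ≥0∞)).toReal = 1 / 2 := by simp
  have hiv := intermediate_value_Icc' (a := -(n : ℝ)) (b := 0) (by simp) hcont.continuousOn
  obtain ⟨t, ht, hval⟩ := hiv (show (1 / 2 : ℝ) ∈ _ from ⟨by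
    rw [hreal, ← hhalf]
    exact ENNReal.toReal_mono (by simp) h0, by
    rw [hreal, ← hhalf]
    exact ENNReal.toReal_mono ((hle _).trans_lt ENNReal.one_lt_top).ne hn.le⟩)
  refine ⟨-t, by linarith [ht.2], ?_⟩
  rw [neg_neg]
  simp only [hreal] at hval
  rw [← hhalf] at hval
  exact (ENNReal.toReal_eq_toReal_iff' ((hle _).trans_lt ENNReal.one_lt_top).ne (by simp)).1 hval

theorem setLIntegral_Ioi_comp_sub (F : ℝ → ℝ≥0∞) (s : ℝ) :
    ∫⁻ x in Set.Ioi 0, F (x - s) = ∫⁻ x in Set.Ioi (-s), F x := by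
  have := (measurePreserving_sub_right (volume : Measure ℝ) s).setLIntegral_comp_preimage_emb
    (MeasurableEquiv.subRight s).measurableEmbedding F (Set.Ioi (-s))
  rw [← this]
  congr 2
  ext x
  simp

theorem setLIntegral_Ioi_comp_neg (F : ℝ → ℝ≥0∞) :
    ∫⁻ x in Set.Ioi 0, F (-x) = ∫⁻ x in Set.Iio 0, F x := by
  have := (Measure.measurePreserving_neg (volume : Measure ℝ)).setLIntegral_comp_preimage_emb
    (MeasurableEquiv.neg ℝ).measurableEmbedding F (Set.Iio 0)
  rw [← this]
  congr 2
  ext x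
  simp

theorem LogConcave.comp_neg {h : ℝ → ℝ≥0∞} (hlc : LogConcave h) :
    LogConcave fun x => h (-x) := by
  intro x y a b ha hb hab
  convert hlc (-x) (-y) a b ha hb hab using 2
  simp only [smul_eq_mul]; ring

theorem LogConcave.comp_sub {h : ℝ → ℝ≥0∞} (hlc : LogConcave h) (s : ℝ) :
    LogConcave fun x => h (x - s) := by
  intro x y a b ha hb hab
  convert hlc (x - s) (y - s) a b ha hb hab using 2
  simp only [smul_eq_mul]
  linear_combination s * hab

/-- After scaling to p + m = 1 the left side is convex on a segment, hence at most its larger end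
value: a^r at m = 0, b^r + 1 at p = 0. -/
theorem rpow_add_rpow_le_max_mul_rpow {a b p m r : ℝ} (ha : 0 ≤ a) (hb : 0 ≤ b) (hp : 0 ≤ p)
    (hm : 0 ≤ m) (hr : 1 ≤ r) :
    (a * p + b * m) ^ r + m ^ r ≤ max (a ^ r) (b ^ r + 1) * (p + m) ^ r := by
  have hr0 : r ≠ 0 := by linarith
  rcases (add_nonneg hp hm).eq_or_lt with h0 | hM
  · have hp0 : p = 0 := by linarith
    have hm0 : m = 0 := by linarith
    simp [hp0, hm0, hr0]
  have hMr : 0 < (p + m) ^ r := Real.rpow_pos_of_pos hM r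
  set t := p / (p + m) with ht
  set u := m / (p + m) with hu
  have htu : t + u = 1 := by rw [ht, hu]; field_simp
  have ht0 : 0 ≤ t := by positivity
  have hu0 : 0 ≤ u := by positivity
  have e1 : a * p + b * m = (p + m) * (t * a + u * b) := by rw [ht, hu]; field_simp
  have e2 : m = (p + m) * u := by rw [hu]; field_simp
  have c1 : (t * a + u * b) ^ r ≤ t * a ^ r + u * b ^ r :=
    (convexOn_rpow hr).2 ha hb ht0 hu0 htu
  have c2 : u ^ r ≤ u := by
    simpa using Real.rpow_le_rpow_of_exponent_ge_of_imp hu0 (by linarith) hr (fun _ h => absurd h hr0)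
  have c3 : (t * a + u * b) ^ r + u ^ r ≤ max (a ^ r) (b ^ r + 1) := by
    have h1 := mul_le_mul_of_nonneg_left (le_max_left (a ^ r) (b ^ r + 1)) ht0
    have h2 := mul_le_mul_of_nonneg_left (le_max_right (a ^ r) (b ^ r + 1)) hu0
    have h3 : t * max (a ^ r) (b ^ r + 1) + u * max (a ^ r) (b ^ r + 1)
      = max (a ^ r) (b ^ r + 1) := by rw [← add_mul, htu, one_mul]
    linarith
  calc (a * p + b * m) ^ r + m ^ r
      = ((p + m) * (t * a + u * b)) ^ r + ((p + m) * u) ^ r := by rw [← e1, ← e2]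
    _ = ((t * a + u * b) ^ r + u ^ r) * (p + m) ^ r := by
      rw [Real.mul_rpow hM.le (by positivity), Real.mul_rpow hM.le hu0]; ring
    _ ≤ _ := by gcongr

theorem ENNReal_rpow_add_rpow_le_max_mul_rpow {a b r : ℝ} (ha : 0 ≤ a) (hb : 0 ≤ b) (hr : 1 ≤ r)
    (p m : ℝ≥0∞) :
    (ENNReal.ofReal a * p + ENNReal.ofReal b * m) ^ r + m ^ r
      ≤ ENNReal.ofReal (max (a ^ r) (b ^ r + 1)) * (p + m) ^ r := by
  have hr0 : 0 ≤ r := by linarith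
  by_cases hM : p + m = ∞
  · rw [hM, ENNReal.top_rpow_of_pos (by linarith), ENNReal.mul_top]
    · exact le_top
    · have : 0 < b ^ r + 1 := by positivity
      simp [this]
  obtain ⟨hp, hm⟩ := ENNReal.add_ne_top.1 hM
  obtain ⟨p', rfl, hp'⟩ : ∃ p' : ℝ, p = ENNReal.ofReal p' ∧ 0 ≤ p' :=
    ⟨_, (ENNReal.ofReal_toReal hp).symm, ENNReal.toReal_nonneg⟩
  obtain ⟨m', rfl, hm'⟩ : ∃ m' : ℝ, m = ENNReal.ofReal m' ∧ 0 ≤ m' :=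
    ⟨_, (ENNReal.ofReal_toReal hm).symm, ENNReal.toReal_nonneg⟩
  rw [← ENNReal.ofReal_mul ha, ← ENNReal.ofReal_mul hb,
    ← ENNReal.ofReal_add (by positivity) (by positivity), ← ENNReal.ofReal_add hp' hm',
    ENNReal.ofReal_rpow_of_nonneg (by positivity) hr0,
    ENNReal.ofReal_rpow_of_nonneg (by positivity) hr0,
    ENNReal.ofReal_rpow_of_nonneg (by positivity) hr0,
    ← ENNReal.ofReal_add (by positivity) (by positivity),
    ← ENNReal.ofReal_mul (by positivity)]
  exact ENNReal.ofReal_le_ofReal (rpow_add_rpow_le_max_mul_rpow ha hb hp' hm' hr)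

/-- The constant in the comparison of the `k`-th and the second moment. -/
noncomputable def momentConst (k : ℝ) : ℝ :=
  Real.Gamma (k + 1) / 2 * max ((17 / 8) ^ (k / 2)) ((17 / 9) ^ (k / 2) + 1)

theorem lintegral_eq_Ioi_add_Ioi_neg (F : ℝ → ℝ≥0∞) :
    ∫⁻ x, F x = (∫⁻ x in Set.Ioi 0, F x) + ∫⁻ x in Set.Ioi 0, F (-x) := by
  rw [setLIntegral_Ioi_comp_neg, ← lintegral_add_compl F measurableSet_Ioi (A := Set.Ioi 0),
    Set.compl_Ioi, setLIntegral_congr Iio_ae_eq_Iic]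

theorem lintegral_enorm_rpow_mul {g : ℝ → ℝ≥0∞} (k : ℝ) :
    ∫⁻ x, ‖x‖ₑ ^ k * g x = (∫⁻ x in Set.Ioi 0, ENNReal.ofReal x ^ k * g x)
      + ∫⁻ x in Set.Ioi 0, ENNReal.ofReal x ^ k * g (-x) := by
  rw [lintegral_eq_Ioi_add_Ioi_neg]
  congr 1
  · refine setLIntegral_congr_fun measurableSet_Ioi fun x hx => ?_
    simp only [Real.enorm_of_nonneg (le_of_lt hx)]
  · refine setLIntegral_congr_fun measurableSet_Ioi fun x hx => ?_
    simp only [enorm_neg, Real.enorm_of_nonneg (le_of_lt hx)]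

/-- Young's inequality with 17/8 = 1 + 9/8 and 17/9 = 1 + 8/9; this weight nearly balances the two
terms of the maximum in `momentConst 4`. -/
theorem sq_ofReal_add_le {x s : ℝ} (hs : 0 ≤ s) :
    ENNReal.ofReal (x + s) ^ 2 ≤ ENNReal.ofReal (17 / 8) * ENNReal.ofReal x ^ 2
      + ENNReal.ofReal (17 / 9) * ENNReal.ofReal s ^ 2 := by
  rcases le_total x 0 with hx | hx
  · rw [ENNReal.ofReal_of_nonpos hx]
    have h1 : ENNReal.ofReal (x + s) ≤ ENNReal.ofReal s :=
      ENNReal.ofReal_le_ofReal (by linarith)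
    calc ENNReal.ofReal (x + s) ^ 2 ≤ 1 * ENNReal.ofReal s ^ 2 := by rw [one_mul]; gcongr
      _ ≤ ENNReal.ofReal (17 / 9) * ENNReal.ofReal s ^ 2 := by
        gcongr
        rw [ENNReal.one_le_ofReal]; norm_num
      _ ≤ _ := le_add_self
  · rw [← ENNReal.ofReal_pow hx, ← ENNReal.ofReal_pow hs, ← ENNReal.ofReal_pow (by positivity),
      ← ENNReal.ofReal_mul (by norm_num), ← ENNReal.ofReal_mul (by norm_num),
      ← ENNReal.ofReal_add (by positivity) (by positivity)]
    refine ENNReal.ofReal_le_ofReal ?_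
    nlinarith [sq_nonneg (9 * x - 8 * s)]

/-- The negative half-line has mass at least 1/2 and is treated directly. The positive one may be
too light, so it is extended to (-s, ∞), of mass exactly 1/2, and translated to start at 0. -/
theorem LogConcave.moment_le_of_Ioi_le_half {g : ℝ → ℝ≥0∞} (hm : Measurable g)
    (hlc : LogConcave g) (h1 : ∫⁻ x, g x = 1) (h0 : ∫⁻ x in Set.Ioi 0, g x ≤ 1 / 2)
    {k : ℝ} (hk : 2 ≤ k) :
    ∫⁻ x, ‖x‖ₑ ^ k * g x
      ≤ ENNReal.ofReal (momentConst k) * (∫⁻ x, ‖x‖ₑ ^ (2 : ℝ) * g x) ^ (k / 2) := by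
  have hG : 0 < Real.Gamma (k + 1) := Real.Gamma_pos_of_pos (by linarith)
  have hr : (1 : ℝ) ≤ k / 2 := by linarith
  obtain ⟨s, hs, hhalf⟩ := exists_lintegral_Ioi_eq_half hm h1 h0
  have hmn : Measurable fun x => g (-x) := hm.comp measurable_neg
  have hms : Measurable fun x => g (x - s) := hm.comp (measurable_sub_const s)
  rw [lintegral_enorm_rpow_mul, lintegral_enorm_rpow_mul]
  simp only [ENNReal.rpow_two]
  set P := ∫⁻ x in Set.Ioi 0, ENNReal.ofReal x ^ 2 * g x with hP
  set N := ∫⁻ x in Set.Ioi 0, ENNReal.ofReal x ^ 2 * g (-x) with hN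
  have hleft : ∫⁻ x in Set.Ioi 0, ENNReal.ofReal x ^ k * g (-x)
      ≤ ENNReal.ofReal (Real.Gamma (k + 1) / 2) * N ^ (k / 2) := by
    have hsum := lintegral_eq_Ioi_add_Ioi_neg g
    rw [h1] at hsum
    refine hlc.comp_neg.lintegral_Ioi_rpow_le hmn hk ?_ ?_
    · by_contra! hcon
      have := ENNReal.add_lt_add_of_le_of_lt (a := ∫⁻ x in Set.Ioi 0, g x)
        (ne_top_of_le_ne_top (by simp) h0) h0 hcon
      rw [← hsum, ENNReal.add_halves] at this
      exact lt_irrefl _ this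
    · rw [hsum]; exact le_add_self
  -- Chebyshev: mass 1/2 lies at or below -s. This pays for the shift by s.
  have hsN : ENNReal.ofReal s ^ 2 * (1 / 2) ≤ N := by
    have hcompl : ∫⁻ x in Set.Iic (-s), g x = 1 / 2 := by
      have := lintegral_add_compl g (μ := volume) (measurableSet_Ioi (a := -s))
      have h2 := ENNReal.add_halves 1
      rw [hhalf, Set.compl_Ioi, h1, ← h2] at this
      nth_rewrite 1 [h2] at this
      exact (ENNReal.add_right_inj (a := 1 / 2) (by simp)).1 this
    rw [← hcompl, ← lintegral_const_mul _ hm, hN]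
    have e := setLIntegral_Ioi_comp_neg fun x => ENNReal.ofReal (-x) ^ 2 * g x
    simp only [neg_neg] at e
    rw [e, setLIntegral_congr Iio_ae_eq_Iic]
    refine le_trans ?_ (lintegral_mono_set (Set.Iic_subset_Iic.2 (show -s ≤ 0 by linarith)))
    refine setLIntegral_mono' measurableSet_Iic fun x hx => ?_
    have hx' : x ≤ -s := hx
    gcongr
    linarith
  have hright2 : ∫⁻ x in Set.Ioi 0, ENNReal.ofReal x ^ 2 * g (x - s)
      ≤ ENNReal.ofReal (17 / 8) * P + ENNReal.ofReal (17 / 9) * N := by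
    have e := setLIntegral_Ioi_comp_sub (fun x => ENNReal.ofReal (x + s) ^ 2 * g x) s
    simp only [sub_add_cancel] at e
    have hPle : ∫⁻ x in Set.Ioi (-s), ENNReal.ofReal x ^ 2 * g x ≤ P := by
      rw [hP, ← lintegral_indicator measurableSet_Ioi, ← lintegral_indicator measurableSet_Ioi]
      refine lintegral_mono fun x => ?_
      refine Set.indicator_le (fun y _ => ?_) x
      by_cases hy : 0 < y
      · rw [Set.indicator_of_mem (show y ∈ Set.Ioi (0 : ℝ) from hy)]
      · simp [ENNReal.ofReal_of_nonpos (not_lt.1 hy)]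
    calc ∫⁻ x in Set.Ioi 0, ENNReal.ofReal x ^ 2 * g (x - s)
        = ∫⁻ x in Set.Ioi (-s), ENNReal.ofReal (x + s) ^ 2 * g x := e
      _ ≤ ∫⁻ x in Set.Ioi (-s), (ENNReal.ofReal (17 / 8) * (ENNReal.ofReal x ^ 2 * g x)
          + ENNReal.ofReal (17 / 9) * ENNReal.ofReal s ^ 2 * g x) := by
        refine lintegral_mono fun x => ?_
        rw [← mul_assoc, ← add_mul]
        gcongr
        exact sq_ofReal_add_le hs
      _ = ENNReal.ofReal (17 / 8) * (∫⁻ x in Set.Ioi (-s), ENNReal.ofReal x ^ 2 * g x)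
          + ENNReal.ofReal (17 / 9) * (ENNReal.ofReal s ^ 2 * (1 / 2)) := by
        rw [lintegral_add_left (by fun_prop), lintegral_const_mul _ (by fun_prop),
          lintegral_const_mul _ hm, hhalf, mul_assoc]
      _ ≤ _ := by gcongr
  have hright : ∫⁻ x in Set.Ioi 0, ENNReal.ofReal x ^ k * g x
      ≤ ENNReal.ofReal (Real.Gamma (k + 1) / 2)
        * (ENNReal.ofReal (17 / 8) * P + ENNReal.ofReal (17 / 9) * N) ^ (k / 2) := by
    have e := setLIntegral_Ioi_comp_sub (fun x => ENNReal.ofReal (x + s) ^ k * g x) s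
    simp only [sub_add_cancel] at e
    have hmass : ∫⁻ x in Set.Ioi 0, g (x - s) = 1 / 2 := by
      rw [setLIntegral_Ioi_comp_sub, hhalf]
    calc ∫⁻ x in Set.Ioi 0, ENNReal.ofReal x ^ k * g x
        ≤ ∫⁻ x in Set.Ioi 0, ENNReal.ofReal (x + s) ^ k * g x := by
          refine lintegral_mono fun x => ?_
          have : x ≤ x + s := by linarith
          gcongr
      _ ≤ ∫⁻ x in Set.Ioi (-s), ENNReal.ofReal (x + s) ^ k * g x :=
          lintegral_mono_set (Set.Ioi_subset_Ioi (by linarith))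
      _ = ∫⁻ x in Set.Ioi 0, ENNReal.ofReal x ^ k * g (x - s) := e.symm
      _ ≤ ENNReal.ofReal (Real.Gamma (k + 1) / 2)
          * (∫⁻ x in Set.Ioi 0, ENNReal.ofReal x ^ 2 * g (x - s)) ^ (k / 2) :=
          (hlc.comp_sub s).lintegral_Ioi_rpow_le hms hk hmass.ge
            (hmass.trans_le ENNReal.half_le_self)
      _ ≤ _ := by gcongr
  calc _ ≤ _ := add_le_add hright hleft
    _ = ENNReal.ofReal (Real.Gamma (k + 1) / 2)
        * ((ENNReal.ofReal (17 / 8) * P + ENNReal.ofReal (17 / 9) * N) ^ (k / 2)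
          + N ^ (k / 2)) := by rw [mul_add]
    _ ≤ _ := by
      rw [momentConst, ENNReal.ofReal_mul (by positivity), mul_assoc]
      gcongr
      exact ENNReal_rpow_add_rpow_le_max_mul_rpow (by norm_num) (by norm_num) hr P N

/-- Moments of log-concave probability densities on the line are bounded in terms of the
second moment. -/
theorem LogConcave.moment_le {g : ℝ → ℝ≥0∞} (hm : Measurable g)
    (hlc : LogConcave g) (h1 : ∫⁻ x, g x = 1) {k : ℝ} (hk : 2 ≤ k) :
    ∫⁻ x, ‖x‖ₑ ^ k * g x
      ≤ ENNReal.ofReal (momentConst k) * (∫⁻ x, ‖x‖ₑ ^ (2 : ℝ) * g x) ^ (k / 2) := by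
  by_cases h0 : ∫⁻ x in Set.Ioi 0, g x ≤ 1 / 2
  · exact hlc.moment_le_of_Ioi_le_half hm h1 h0 hk
  · have hneg : ∫⁻ x, g (-x) = 1 := by
      rw [lintegral_eq_Ioi_add_Ioi_neg, ← h1, lintegral_eq_Ioi_add_Ioi_neg g, add_comm]
      simp
    have h0' : ∫⁻ x in Set.Ioi 0, g (-x) ≤ 1 / 2 := by
      by_contra! hcon
      have := ENNReal.add_lt_add (not_le.1 h0) hcon
      rw [← lintegral_eq_Ioi_add_Ioi_neg, h1, ENNReal.add_halves] at this
      exact lt_irrefl _ this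
    have hmn : Measurable fun x => g (-x) := hm.comp measurable_neg
    have := hlc.comp_neg.moment_le_of_Ioi_le_half hmn hneg h0' hk
    rw [lintegral_enorm_rpow_mul, lintegral_enorm_rpow_mul] at this ⊢
    simpa only [neg_neg, add_comm] using this

/-! ### From coordinates to a dimension-free moment bound. -/

theorem lintegral_Lp_sum_le {α ι : Type*} [MeasurableSpace α] {μ : Measure α} {r : ℝ} (hr : 1 ≤ r)
    (s : Finset ι) {u : ι → α → ℝ≥0∞} (hu : ∀ i, Measurable (u i)) :
    (∫⁻ x, (∑ i ∈ s, u i x) ^ r ∂μ) ^ (1 / r) ≤ ∑ i ∈ s, (∫⁻ x, u i x ^ r ∂μ) ^ (1 / r) := by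
  classical
  have hr0 : 0 < r := by linarith
  induction s using Finset.induction with
  | empty => simp [hr0]
  | insert i s hi ih =>
    simp_rw [Finset.sum_insert hi]
    refine (ENNReal.lintegral_Lp_add_le (hu i).aemeasurable (g := fun x => ∑ i ∈ s, u i x)
      (Finset.measurable_sum _ fun i _ => hu i).aemeasurable hr).trans ?_
    gcongr

theorem IsLogConcaveDensity.logConcave_ofReal {p : ℕ} {π : EuclideanSpace ℝ (Fin p) → ℝ}
    (h : IsLogConcaveDensity π) :
    LogConcave fun x : Fin p → ℝ => ENNReal.ofReal (π (WithLp.toLp 2 x)) := by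
  intro x y a b ha hb hab
  simp only
  rw [ENNReal.ofReal_rpow_of_nonneg (h.nonneg _) ha.le,
    ENNReal.ofReal_rpow_of_nonneg (h.nonneg _) hb.le,
    ← ENNReal.ofReal_mul (Real.rpow_nonneg (h.nonneg _) _)]
  exact ENNReal.ofReal_le_ofReal (h.logConcave _ _ a b ha hb hab)

theorem lintegral_law {p : ℕ} {π : EuclideanSpace ℝ (Fin p) → ℝ} (hπ : Measurable π)
    {F : EuclideanSpace ℝ (Fin p) → ℝ≥0∞} (hF : Measurable F) :
    ∫⁻ θ, F θ ∂law π = ∫⁻ θ, F θ * ENNReal.ofReal (π θ) := by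
  rw [law, lintegral_withDensity_eq_lintegral_mul _ hπ.ennreal_ofReal hF]
  simp only [Pi.mul_apply, mul_comm]

theorem lintegral_toLp {p : ℕ} {F : EuclideanSpace ℝ (Fin p) → ℝ≥0∞} (hF : Measurable F) :
    ∫⁻ θ, F θ = ∫⁻ x : Fin p → ℝ, F (WithLp.toLp 2 x) :=
  ((PiLp.volume_preserving_toLp (Fin p)).lintegral_comp hF).symm

theorem enorm_toLp_rpow {p : ℕ} (x : Fin p → ℝ) (k : ℝ) :
    ‖(WithLp.toLp 2 x : EuclideanSpace ℝ (Fin p))‖ₑ ^ k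
      = (∑ i, ‖x i‖ₑ ^ (2 : ℝ)) ^ (k / 2) := by
  have h2 : ‖(WithLp.toLp 2 x : EuclideanSpace ℝ (Fin p))‖ₑ ^ (2 : ℝ)
      = ∑ i, ‖x i‖ₑ ^ (2 : ℝ) := by
    simp only [ENNReal.rpow_two, ← ofReal_norm]
    rw [← ENNReal.ofReal_pow (norm_nonneg _), EuclideanSpace.norm_sq_eq,
      ENNReal.ofReal_sum_of_nonneg fun i _ => by positivity]
    exact Finset.sum_congr rfl fun i _ => ENNReal.ofReal_pow (norm_nonneg _) 2
  rw [← h2, ← ENNReal.rpow_mul]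
  congr 1
  ring

/-- Dimension-free moment comparison for log-concave densities. -/
theorem IsLogConcaveDensity.moment_le {p : ℕ} {π : EuclideanSpace ℝ (Fin p) → ℝ}
    (h : IsLogConcaveDensity π) {k : ℝ} (hk : 2 ≤ k) :
    ∫⁻ θ, ‖θ‖ₑ ^ k ∂law π
      ≤ ENNReal.ofReal (momentConst k) * secondMoment (law π) ^ (k / 2) := by
  have hr : (1 : ℝ) ≤ k / 2 := by linarith
  have hr0 : (0 : ℝ) < k / 2 := by linarith
  have hπ := h.measurable
  set f : (Fin p → ℝ) → ℝ≥0∞ := fun x => ENNReal.ofReal (π (WithLp.toLp 2 x)) with hf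
  have hfm : Measurable f := by fun_prop
  have hlc : LogConcave f := h.logConcave_ofReal
  have hf1 : ∫⁻ x, f x = 1 := by
    rw [← h.lintegral_eq_one, lintegral_toLp (by fun_prop)]
  have moment : ∀ l : ℝ, ∫⁻ θ, ‖θ‖ₑ ^ l ∂law π
      = ∫⁻ x, (∑ i, ‖x i‖ₑ ^ (2 : ℝ)) ^ (l / 2) ∂volume.withDensity f := by
    intro l
    rw [lintegral_law hπ (by fun_prop), lintegral_toLp (by fun_prop),
      lintegral_withDensity_eq_lintegral_mul _ hfm (by fun_prop)]
    simp only [enorm_toLp_rpow, Pi.mul_apply, mul_comm, hf]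
  have coord : ∀ (i : Fin p) (l : ℝ), ∫⁻ x, ‖x i‖ₑ ^ l ∂volume.withDensity f
      = ∫⁻ t, ‖t‖ₑ ^ l * coordMarginal f i t := by
    intro i l
    rw [← lintegral_mul_coordMarginal hfm i (by fun_prop),
      lintegral_withDensity_eq_lintegral_mul _ hfm (by fun_prop)]
    simp only [Pi.mul_apply, mul_comm]
  have mass : ∀ i : Fin p, ∫⁻ t, coordMarginal f i t = 1 := by
    intro i
    have := lintegral_mul_coordMarginal hfm i (F := fun _ => 1) measurable_const
    simpa [hf1] using this.symm
  have hcoord : ∀ i : Fin p, ∫⁻ x, (‖x i‖ₑ ^ (2 : ℝ)) ^ (k / 2) ∂volume.withDensity f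
      ≤ ENNReal.ofReal (momentConst k)
        * (∫⁻ x, ‖x i‖ₑ ^ (2 : ℝ) ∂volume.withDensity f) ^ (k / 2) := by
    intro i
    simp_rw [← ENNReal.rpow_mul, mul_div_cancel₀ k (two_ne_zero' ℝ)]
    rw [coord, coord]
    exact (hlc.coordMarginal hfm i).moment_le (measurable_coordMarginal hfm i) (mass i) hk
  have hsm : secondMoment (law π)
      = ∑ i, ∫⁻ x, ‖x i‖ₑ ^ (2 : ℝ) ∂volume.withDensity f := by
    have := moment 2
    simp only [ENNReal.rpow_two, div_self (two_ne_zero' ℝ), ENNReal.rpow_one] at this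
    rw [secondMoment, this, lintegral_finsetSum _ (fun i _ => by fun_prop)]
    simp only [ENNReal.rpow_two]
  have hmink := lintegral_Lp_sum_le (μ := volume.withDensity f) hr Finset.univ
    (u := fun i x => ‖x i‖ₑ ^ (2 : ℝ)) (fun i => by fun_prop)
  rw [← moment] at hmink
  -- After taking the root, each coordinate contributes the same constant times its second moment.
  -- These sum to the full second moment, so no factor of `p` appears.
  have hroot : (∫⁻ θ, ‖θ‖ₑ ^ k ∂law π) ^ (1 / (k / 2))
      ≤ ENNReal.ofReal (momentConst k) ^ (1 / (k / 2)) * secondMoment (law π) := by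
    refine hmink.trans ?_
    rw [hsm, Finset.mul_sum]
    refine Finset.sum_le_sum fun i _ => ?_
    refine (ENNReal.rpow_le_rpow (hcoord i) (by positivity)).trans_eq ?_
    rw [ENNReal.mul_rpow_of_nonneg _ _ (by positivity), ← ENNReal.rpow_mul,
      mul_one_div_cancel hr0.ne', ENNReal.rpow_one]
  have := ENNReal.rpow_le_rpow hroot hr0.le
  rwa [← ENNReal.rpow_mul, one_div_mul_cancel hr0.ne', ENNReal.rpow_one,
    ENNReal.mul_rpow_of_nonneg _ _ hr0.le, ← ENNReal.rpow_mul, one_div_mul_cancel hr0.ne',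
    ENNReal.rpow_one] at this

theorem momentConst_three_le : momentConst 3 ≤ 22 := by
  have hG : Real.Gamma (3 + 1) = 6 := by
    have := Real.Gamma_nat_eq_factorial 3
    norm_num [Nat.factorial] at this ⊢
  have h1 : (17 / 8 : ℝ) ^ (3 / 2 : ℝ) ≤ (17 / 8) ^ (2 : ℝ) :=
    Real.rpow_le_rpow_of_exponent_le (by norm_num) (by norm_num)
  have h2 : (17 / 9 : ℝ) ^ (3 / 2 : ℝ) ≤ (17 / 9) ^ (2 : ℝ) :=
    Real.rpow_le_rpow_of_exponent_le (by norm_num) (by norm_num)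
  rw [Real.rpow_two] at h1 h2
  have h3 : max ((17 / 8 : ℝ) ^ (3 / 2 : ℝ)) ((17 / 9) ^ (3 / 2 : ℝ) + 1) ≤ 5 :=
    max_le (by linarith) (by linarith)
  rw [momentConst, hG]
  linarith

theorem momentConst_four_le : 2 * momentConst 4 ≤ 111 := by
  have hG : Real.Gamma (4 + 1) = 24 := by
    have := Real.Gamma_nat_eq_factorial 4
    norm_num [Nat.factorial] at this ⊢
  -- Since Γ(5)/2 = 12, the bound 37/8 yields exactly 2 · 12 · 37/8 = 111.
  have h3 : max ((17 / 8 : ℝ) ^ (4 / 2 : ℝ)) ((17 / 9) ^ (4 / 2 : ℝ) + 1) ≤ 37 / 8 := by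
    rw [show (4 / 2 : ℝ) = 2 by norm_num, Real.rpow_two, Real.rpow_two]
    exact max_le (by norm_num) (by norm_num)
  rw [momentConst, hG]
  linarith

/-! ### Total variation and the maximal coupling of two densities. -/

section Densities

variable {p : ℕ}

local notation "E" => EuclideanSpace ℝ (Fin p)

theorem lintegral_tsub_comm_of_eq {f g : E → ℝ≥0∞} (hf : Measurable f) (hg : Measurable g)
    (hfg : ∫⁻ x, f x = ∫⁻ x, g x) (hfin : ∫⁻ x, f x ≠ ∞) :
    ∫⁻ x, (f x - g x) = ∫⁻ x, (g x - f x) := by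
  have h1 : (∫⁻ x, f x) + ∫⁻ x, (g x - f x) = (∫⁻ x, g x) + ∫⁻ x, (f x - g x) := by
    rw [← lintegral_add_left hf, ← lintegral_add_left hg]
    simp only [add_tsub_eq_max, max_comm]
  rw [← hfg] at h1
  exact ((ENNReal.add_right_inj hfin).1 h1).symm

theorem tvDist_withDensity_le {f g : E → ℝ≥0∞} (hf : Measurable f) (hg : Measurable g)
    (hf1 : ∫⁻ x, f x = 1) (hg1 : ∫⁻ x, g x = 1) :
    tvDist (volume.withDensity f) (volume.withDensity g) ≤ 2 * ∫⁻ x, (f x - g x) := by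
  have hδ : ∫⁻ x, (f x - g x) ≠ ∞ :=
    ne_top_of_le_ne_top (by simp [hf1]) (lintegral_mono fun x => (tsub_le_self : f x - g x ≤ f x))
  have aux : ∀ {u v : E → ℝ≥0∞}, Measurable u → Measurable v → ∀ A, MeasurableSet A →
      volume.withDensity u A ≤ volume.withDensity v A + ∫⁻ x, (u x - v x) := by
    intro u v hu hv A hA
    rw [withDensity_apply _ hA, withDensity_apply _ hA]
    calc ∫⁻ x in A, u x ≤ ∫⁻ x in A, (v x + (u x - v x)) :=
          lintegral_mono fun x => le_add_tsub
      _ = (∫⁻ x in A, v x) + ∫⁻ x in A, (u x - v x) := lintegral_add_left hv _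
      _ ≤ _ := add_le_add_right (setLIntegral_le_lintegral _ _) _
  have fin : ∀ {u : E → ℝ≥0∞}, ∫⁻ x, u x = 1 → ∀ A, MeasurableSet A →
      volume.withDensity u A ≠ ∞ := by
    intro u hu A hA
    rw [withDensity_apply _ hA]
    exact ne_top_of_le_ne_top (by simp [hu]) (setLIntegral_le_lintegral _ _)
  unfold tvDist
  gcongr
  refine iSup₂_le fun A hA => ?_
  have h1 := aux hf hg A hA
  have h2 := aux hg hf A hA
  rw [← lintegral_tsub_comm_of_eq hf hg (hf1.trans hg1.symm) (by simp [hf1])] at h2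
  have r1 := ENNReal.toReal_mono (ENNReal.add_ne_top.2 ⟨fin hg1 A hA, hδ⟩) h1
  have r2 := ENNReal.toReal_mono (ENNReal.add_ne_top.2 ⟨fin hf1 A hA, hδ⟩) h2
  rw [ENNReal.toReal_add (fin hg1 A hA) hδ] at r1
  rw [ENNReal.toReal_add (fin hf1 A hA) hδ] at r2
  refine ENNReal.ofReal_le_of_le_toReal (abs_sub_le_iff.2 ⟨?_, ?_⟩) <;>
    simp only [Measure.real] <;> linarith

/-- The coupling that leaves the common part of two densities in place and couples the
remaining parts independently. -/
noncomputable def maximalCoupling (f g : E → ℝ≥0∞) : Measure (E × E) :=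
  (volume.withDensity fun x => min (f x) (g x)).map (fun x => (x, x))
    + (∫⁻ x, (f x - g x))⁻¹ •
      (volume.withDensity fun x => f x - g x).prod (volume.withDensity fun x => g x - f x)

theorem isFiniteMeasure_withDensity_tsub {f g : E → ℝ≥0∞} (hf1 : ∫⁻ x, f x = 1) :
    IsFiniteMeasure (volume.withDensity fun x => f x - g x) :=
  isFiniteMeasure_withDensity (ne_top_of_le_ne_top (by simp [hf1])
    (lintegral_mono fun x => (tsub_le_self : f x - g x ≤ f x)))

theorem withDensity_min_add_tsub {f g : E → ℝ≥0∞} (hf : Measurable f) (hg : Measurable g) :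
    (volume.withDensity fun x => min (f x) (g x)) + volume.withDensity (fun x => f x - g x)
      = volume.withDensity f := by
  rw [← withDensity_add_left (hf.min hg)]
  congr 1
  ext x
  simp only [Pi.add_apply]
  rw [add_comm, tsub_add_min]

/-- This covers equal densities too: for d = 0 the factor d⁻¹ = ∞ multiplies the zero measure, so
`maximalCoupling` needs no case distinction. -/
theorem inv_smul_smul_withDensity {f : E → ℝ≥0∞} {d : ℝ≥0∞} (hf : Measurable f)
    (hd : ∫⁻ x, f x = d) (hfin : d ≠ ∞) :
    d⁻¹ • d • volume.withDensity f = volume.withDensity f := by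
  by_cases h0 : d = 0
  · have : volume.withDensity f = 0 := by
      rw [withDensity_eq_zero_iff hf.aemeasurable]
      exact (lintegral_eq_zero_iff hf).1 (hd.trans h0)
    rw [this]; simp
  · rw [smul_smul, ENNReal.inv_mul_cancel h0 hfin, one_smul]

theorem maximalCoupling_mem_couplings {f g : E → ℝ≥0∞} (hf : Measurable f) (hg : Measurable g)
    (hf1 : ∫⁻ x, f x = 1) (hg1 : ∫⁻ x, g x = 1) :
    maximalCoupling f g ∈ couplings (volume.withDensity f) (volume.withDensity g) := by
  have hδ : ∫⁻ x, (f x - g x) ≠ ∞ :=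
    ne_top_of_le_ne_top (by simp [hf1]) (lintegral_mono fun x => (tsub_le_self : f x - g x ≤ f x))
  have hcomm := lintegral_tsub_comm_of_eq hf hg (hf1.trans hg1.symm) (by simp [hf1])
  have i1 := isFiniteMeasure_withDensity_tsub (g := g) hf1
  have i2 := isFiniteMeasure_withDensity_tsub (g := f) hg1
  have hfg : Measurable fun x => f x - g x := hf.sub hg
  have hgf : Measurable fun x => g x - f x := hg.sub hf
  have hdiag : Measurable fun x : E => (x, x) := measurable_id.prodMk measurable_id
  constructor
  · rw [maximalCoupling, Measure.map_add _ _ measurable_fst, Measure.map_smul,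
      Measure.map_map measurable_fst hdiag, Measure.map_fst_prod,
      withDensity_apply _ MeasurableSet.univ, setLIntegral_univ, ← hcomm,
      inv_smul_smul_withDensity hfg rfl hδ]
    exact (congrArg (· + _) Measure.map_id).trans (withDensity_min_add_tsub hf hg)
  · rw [maximalCoupling, Measure.map_add _ _ measurable_snd, Measure.map_smul,
      Measure.map_map measurable_snd hdiag, Measure.map_snd_prod,
      withDensity_apply _ MeasurableSet.univ, setLIntegral_univ,
      inv_smul_smul_withDensity hgf hcomm.symm hδ]
    refine (congrArg (· + _) Measure.map_id).trans ?_
    simp only [min_comm (f _)]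
    exact withDensity_min_add_tsub hg hf

/-- The diagonal part costs nothing. On the residual part `hnorm` gives ‖x - y‖ ≤ 2‖x‖, a cost
depending on x alone, and the residual mass in y cancels the normalising factor. -/
theorem wasserstein_rpow_withDensity_le {f g : E → ℝ≥0∞} (hf : Measurable f) (hg : Measurable g)
    (hf1 : ∫⁻ x, f x = 1) (hg1 : ∫⁻ x, g x = 1)
    (hnorm : ∀ x y, f x - g x ≠ 0 → g y - f y ≠ 0 → ‖y‖ₑ ≤ ‖x‖ₑ) {q : ℝ} (hq : 0 < q) :
    wasserstein q (volume.withDensity f) (volume.withDensity g) ^ q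
      ≤ 2 ^ q * ∫⁻ x, ‖x‖ₑ ^ q * (f x - g x) := by
  have hδ : ∫⁻ x, (f x - g x) ≠ ∞ :=
    ne_top_of_le_ne_top (by simp [hf1]) (lintegral_mono fun x => (tsub_le_self : f x - g x ≤ f x))
  have hcomm := lintegral_tsub_comm_of_eq hf hg (hf1.trans hg1.symm) (by simp [hf1])
  have i1 := isFiniteMeasure_withDensity_tsub (g := g) hf1
  have i2 := isFiniteMeasure_withDensity_tsub (g := f) hg1
  have hfg : Measurable fun x => f x - g x := hf.sub hg
  have hgf : Measurable fun x => g x - f x := hg.sub hf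
  have hdiag : Measurable fun x : E => (x, x) := measurable_id.prodMk measurable_id
  have hcost : Measurable fun z : E × E => ‖z.1 - z.2‖ₑ ^ q := by fun_prop
  have hW : wasserstein q (volume.withDensity f) (volume.withDensity g) ^ q
      ≤ ∫⁻ z, ‖z.1 - z.2‖ₑ ^ q ∂maximalCoupling f g := by
    have h1 : wasserstein q (volume.withDensity f) (volume.withDensity g)
        ≤ (∫⁻ z, ‖z.1 - z.2‖ₑ ^ q ∂maximalCoupling f g) ^ (1 / q) :=
      iInf₂_le _ (maximalCoupling_mem_couplings hf hg hf1 hg1)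
    have h2 := ENNReal.rpow_le_rpow h1 hq.le
    rwa [← ENNReal.rpow_mul, one_div_mul_cancel hq.ne', ENNReal.rpow_one] at h2
  refine hW.trans ?_
  rw [maximalCoupling, lintegral_add_measure, lintegral_map hcost hdiag, lintegral_smul_measure]
  simp only [sub_self, enorm_zero, ENNReal.zero_rpow_of_pos hq, lintegral_zero, zero_add]
  rw [lintegral_prod _ hcost.aemeasurable, lintegral_withDensity_eq_lintegral_mul _ hfg
    hcost.lintegral_prod_right']
  have inner : ∀ x, (f x - g x) *
      (∫⁻ y, ‖x - y‖ₑ ^ q ∂volume.withDensity fun x => g x - f x)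
      ≤ (∫⁻ x, (f x - g x)) * (2 ^ q * (‖x‖ₑ ^ q * (f x - g x))) := by
    intro x
    by_cases hx : f x - g x = 0
    · simp [hx]
    have : ∫⁻ y, ‖x - y‖ₑ ^ q ∂volume.withDensity (fun x => g x - f x)
        ≤ 2 ^ q * ‖x‖ₑ ^ q * ∫⁻ x, (f x - g x) := by
      rw [lintegral_withDensity_eq_lintegral_mul _ hgf (by fun_prop), hcomm,
        ← lintegral_const_mul _ hgf]
      refine lintegral_mono fun y => ?_
      simp only [Pi.mul_apply]
      by_cases hy : g y - f y = 0
      · simp [hy]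
      rw [mul_comm]
      gcongr
      rw [← ENNReal.mul_rpow_of_nonneg _ _ hq.le]
      refine ENNReal.rpow_le_rpow ?_ hq.le
      calc ‖x - y‖ₑ ≤ ‖x‖ₑ + ‖y‖ₑ := enorm_sub_le
        _ ≤ ‖x‖ₑ + ‖x‖ₑ := by gcongr; exact hnorm x y hx hy
        _ = 2 * ‖x‖ₑ := (two_mul _).symm
    calc _ ≤ (f x - g x) * (2 ^ q * ‖x‖ₑ ^ q * ∫⁻ x, (f x - g x)) := by gcongr
      _ = _ := by ring
  have outer : ∫⁻ x, (f x - g x) * (∫⁻ y, ‖x - y‖ₑ ^ q ∂volume.withDensity fun x => g x - f x)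
      ≤ (∫⁻ x, (f x - g x)) * (2 ^ q * ∫⁻ x, ‖x‖ₑ ^ q * (f x - g x)) := by
    refine (lintegral_mono inner).trans_eq ?_
    rw [lintegral_const_mul' _ _ hδ, lintegral_const_mul' _ _ (by simp)]
  refine (mul_le_mul_right outer _).trans ?_
  rw [← mul_assoc]
  exact (mul_le_mul_left (ENNReal.inv_mul_le_one _) _).trans_eq (one_mul _)

end Densities

/-! ### Pointwise comparison of π with its surrogate. -/

section Surrogate

variable {p : ℕ} {π : EuclideanSpace ℝ (Fin p) → ℝ} {α : ℝ}

theorem IsLogConcaveDensity.integrable (h : IsLogConcaveDensity π) : Integrable π := by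
  refine ⟨h.measurable.aestronglyMeasurable, ?_⟩
  rw [hasFiniteIntegral_iff_ofReal (ae_of_all _ h.nonneg), h.lintegral_eq_one]
  exact ENNReal.one_lt_top

theorem IsLogConcaveDensity.integrable_mul_exp (h : IsLogConcaveDensity π) (hα : 0 ≤ α) :
    Integrable fun v => π v * Real.exp (-(α * ‖v‖ ^ 2 / 2)) := by
  have hm := h.measurable
  refine h.integrable.mono' (by fun_prop) (ae_of_all _ fun v => ?_)
  rw [Real.norm_of_nonneg (mul_nonneg (h.nonneg v) (Real.exp_pos _).le)]
  refine mul_le_of_le_one_right (h.nonneg v) (Real.exp_le_one_iff.2 ?_)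
  rw [neg_nonpos]; positivity

theorem IsLogConcaveDensity.normaliser_le_one (h : IsLogConcaveDensity π) (hα : 0 ≤ α) :
    ∫ v, π v * Real.exp (-(α * ‖v‖ ^ 2 / 2)) ≤ 1 := by
  have h1 : ∫ v, π v = 1 := by
    rw [integral_eq_lintegral_of_nonneg_ae (ae_of_all _ h.nonneg)
      h.measurable.aestronglyMeasurable, h.lintegral_eq_one, ENNReal.toReal_one]
  rw [← h1]
  refine integral_mono (h.integrable_mul_exp hα) h.integrable fun v => ?_
  refine mul_le_of_le_one_right (h.nonneg v) (Real.exp_le_one_iff.2 ?_)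
  rw [neg_nonpos]; positivity

theorem IsLogConcaveDensity.normaliser_pos (h : IsLogConcaveDensity π) (hα : 0 ≤ α) :
    0 < ∫ v, π v * Real.exp (-(α * ‖v‖ ^ 2 / 2)) := by
  have hnn : ∀ v, 0 ≤ π v * Real.exp (-(α * ‖v‖ ^ 2 / 2)) := fun v =>
    mul_nonneg (h.nonneg v) (Real.exp_pos _).le
  refine (integral_nonneg hnn).lt_of_ne fun h0 => ?_
  have hz := (integral_eq_zero_iff_of_nonneg hnn (h.integrable_mul_exp hα)).1 h0.symm
  have : ∫⁻ x, ENNReal.ofReal (π x) = 0 := by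
    rw [lintegral_eq_zero_iff h.measurable.ennreal_ofReal]
    filter_upwards [hz] with v hv
    simp only [Pi.zero_apply, mul_eq_zero, (Real.exp_pos _).ne', or_false] at hv
    simp [hv]
  rw [h.lintegral_eq_one] at this
  exact one_ne_zero this

theorem IsLogConcaveDensity.surrogate_nonneg (h : IsLogConcaveDensity π) (hα : 0 ≤ α)
    (x : EuclideanSpace ℝ (Fin p)) : 0 ≤ surrogate α π x :=
  div_nonneg (mul_nonneg (h.nonneg x) (Real.exp_pos _).le) (h.normaliser_pos hα).le

theorem IsLogConcaveDensity.measurable_surrogate (h : IsLogConcaveDensity π) :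
    Measurable (surrogate α π) := by
  have hm := h.measurable
  unfold surrogate
  fun_prop

theorem IsLogConcaveDensity.lintegral_surrogate (h : IsLogConcaveDensity π) (hα : 0 ≤ α) :
    ∫⁻ x, ENNReal.ofReal (surrogate α π x) = 1 := by
  have hint : Integrable (surrogate α π) := (h.integrable_mul_exp hα).div_const _
  rw [← ofReal_integral_eq_lintegral_ofReal hint (ae_of_all _ (h.surrogate_nonneg hα))]
  unfold surrogate
  rw [integral_div, div_self (h.normaliser_pos hα).ne', ENNReal.ofReal_one]

theorem IsLogConcaveDensity.ofReal_sub_surrogate_le (h : IsLogConcaveDensity π) (hα : 0 ≤ α)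
    (x : EuclideanSpace ℝ (Fin p)) :
    ENNReal.ofReal (π x) - ENNReal.ofReal (surrogate α π x)
      ≤ ENNReal.ofReal (α / 2) * (‖x‖ₑ ^ 2 * ENNReal.ofReal (π x)) := by
  have hc := h.normaliser_pos hα
  -- Dividing by a normaliser at most 1 can only increase the density.
  have h1 : π x * Real.exp (-(α * ‖x‖ ^ 2 / 2)) ≤ surrogate α π x :=
    le_div_self (mul_nonneg (h.nonneg x) (Real.exp_pos _).le) hc (h.normaliser_le_one hα)
  have h2 : 1 - α * ‖x‖ ^ 2 / 2 ≤ Real.exp (-(α * ‖x‖ ^ 2 / 2)) := by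
    have := Real.add_one_le_exp (-(α * ‖x‖ ^ 2 / 2))
    linarith
  rw [← ENNReal.ofReal_sub _ (h.surrogate_nonneg hα x), ← ofReal_norm,
    ← ENNReal.ofReal_pow (norm_nonneg _), ← ENNReal.ofReal_mul (by positivity),
    ← ENNReal.ofReal_mul (by positivity)]
  refine ENNReal.ofReal_le_ofReal ?_
  have := mul_le_mul_of_nonneg_left h2 (h.nonneg x)
  nlinarith

/-- The sign of π - π_α is decided by whether the Gaussian factor is below or above the normaliser,
and that factor is a nonincreasing function of the norm. -/
theorem IsLogConcaveDensity.enorm_le_of_surrogate (h : IsLogConcaveDensity π) (hα : 0 ≤ α)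
    (x y : EuclideanSpace ℝ (Fin p))
    (hx : ENNReal.ofReal (π x) - ENNReal.ofReal (surrogate α π x) ≠ 0)
    (hy : ENNReal.ofReal (surrogate α π y) - ENNReal.ofReal (π y) ≠ 0) : ‖y‖ₑ ≤ ‖x‖ₑ := by
  have hc := h.normaliser_pos hα
  rw [Ne, tsub_eq_zero_iff_le, not_le] at hx hy
  have hx' := (ENNReal.ofReal_lt_ofReal_iff_of_nonneg (h.surrogate_nonneg hα x)).1 hx
  have hy' := (ENNReal.ofReal_lt_ofReal_iff_of_nonneg (h.nonneg y)).1 hy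
  unfold surrogate at hx' hy'
  rw [div_lt_iff₀ hc] at hx'
  rw [lt_div_iff₀ hc] at hy'
  have h1 := lt_of_mul_lt_mul_left hx' (h.nonneg x)
  have h2 := lt_of_mul_lt_mul_left hy' (h.nonneg y)
  have h3 := Real.exp_lt_exp.1 (h1.trans h2)
  have h4 : α * ‖y‖ ^ 2 < α * ‖x‖ ^ 2 := by linarith
  have h5 := lt_of_mul_lt_mul_left h4 hα
  have h6 : ‖y‖ ≤ ‖x‖ := (lt_of_pow_lt_pow_left₀ 2 (norm_nonneg _) h5).le
  rw [← ofReal_norm, ← ofReal_norm]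
  exact ENNReal.ofReal_le_ofReal h6

theorem two_mul_ofReal_half (a : ℝ) : 2 * ENNReal.ofReal (a / 2) = ENNReal.ofReal a := by
  rw [← ENNReal.ofReal_ofNat 2, ← ENNReal.ofReal_mul (by norm_num)]
  congr 1; ring

theorem IsLogConcaveDensity.tvDist_surrogate_le (h : IsLogConcaveDensity π) (hα : 0 ≤ α) :
    tvDist (law π) (law (surrogate α π)) ≤ ENNReal.ofReal α * secondMoment (law π) := by
  refine (tvDist_withDensity_le h.measurable.ennreal_ofReal h.measurable_surrogate.ennreal_ofReal
    h.lintegral_eq_one (h.lintegral_surrogate hα)).trans ?_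
  rw [secondMoment, lintegral_law h.measurable (by fun_prop), ← two_mul_ofReal_half, mul_assoc,
    ← lintegral_const_mul' _ _ ENNReal.ofReal_ne_top]
  gcongr with x
  exact h.ofReal_sub_surrogate_le hα x

theorem IsLogConcaveDensity.wasserstein_surrogate_le (h : IsLogConcaveDensity π) (hα : 0 ≤ α)
    {q : ℝ} (hq : 0 < q) :
    wasserstein q (law π) (law (surrogate α π)) ^ q
      ≤ 2 ^ (q - 1) * (ENNReal.ofReal α * ∫⁻ x, ‖x‖ₑ ^ (q + 2) ∂law π) := by
  refine (wasserstein_rpow_withDensity_le h.measurable.ennreal_ofReal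
    h.measurable_surrogate.ennreal_ofReal h.lintegral_eq_one (h.lintegral_surrogate hα)
    (h.enorm_le_of_surrogate hα) hq).trans ?_
  have e : (2 : ℝ≥0∞) ^ q = 2 ^ (q - 1) * 2 := by
    conv_rhs => rw [← ENNReal.rpow_one 2, ← ENNReal.rpow_mul, one_mul]
    rw [← ENNReal.rpow_add _ _ (by norm_num) (by norm_num), sub_add_cancel]
  rw [e, mul_assoc, ← two_mul_ofReal_half, mul_assoc, lintegral_law h.measurable (by fun_prop),
    ← lintegral_const_mul' _ _ ENNReal.ofReal_ne_top]
  refine mul_le_mul_right (mul_le_mul_right (lintegral_mono fun x => ?_) _) _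
  calc ‖x‖ₑ ^ q * (ENNReal.ofReal (π x) - ENNReal.ofReal (surrogate α π x))
      ≤ ‖x‖ₑ ^ q * (ENNReal.ofReal (α / 2) * (‖x‖ₑ ^ 2 * ENNReal.ofReal (π x))) := by
        gcongr
        exact h.ofReal_sub_surrogate_le hα x
    _ = ENNReal.ofReal (α / 2) * (‖x‖ₑ ^ (q + 2) * ENNReal.ofReal (π x)) := by
      rw [ENNReal.rpow_add_of_nonneg _ _ hq.le (by norm_num), ENNReal.rpow_two]
      ring

end Surrogate

end LogConcaveSampling

theorem mainTheorem5 :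
    (∀ (p : ℕ) (π : EuclideanSpace ℝ (Fin p) → ℝ) (α : ℝ),
      LogConcaveSampling.IsLogConcaveDensity π → 0 ≤ α →
      LogConcaveSampling.tvDist (LogConcaveSampling.law π)
          (LogConcaveSampling.law (LogConcaveSampling.surrogate α π)) ≤
        ENNReal.ofReal α * LogConcaveSampling.secondMoment (LogConcaveSampling.law π)) ∧
    ∃ C : ℝ → ℝ≥0, C 1 ≤ 22 ∧ C 2 ≤ 111 ∧
      ∀ q : ℝ, 1 ≤ q →
        ∀ (p : ℕ) (π : EuclideanSpace ℝ (Fin p) → ℝ) (α : ℝ),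
          LogConcaveSampling.IsLogConcaveDensity π → 0 ≤ α →
          LogConcaveSampling.wasserstein q (LogConcaveSampling.law π)
              (LogConcaveSampling.law (LogConcaveSampling.surrogate α π)) ^ q ≤
            (C q : ℝ≥0∞) * ENNReal.ofReal α *
              LogConcaveSampling.secondMoment (LogConcaveSampling.law π) ^ ((q + 2) / 2) := by
  refine ⟨fun p π α h hα => h.tvDist_surrogate_le hα,
    -- The coupling and the pointwise bound give 2^q/2; the moment comparison is used at order q +
    -- 2.
    fun q => Real.toNNReal (2 ^ (q - 1) * LogConcaveSampling.momentConst (q + 2)), ?_, ?_, ?_⟩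
  · rw [Real.toNNReal_le_iff_le_coe]
    have := LogConcaveSampling.momentConst_three_le
    norm_num
    exact this
  · rw [Real.toNNReal_le_iff_le_coe]
    have := LogConcaveSampling.momentConst_four_le
    norm_num
    exact this
  · intro q hq p π α h hα
    refine (h.wasserstein_surrogate_le hα (by linarith)).trans ?_
    have hm := h.moment_le (k := q + 2) (by linarith)
    have e : ((Real.toNNReal (2 ^ (q - 1) * LogConcaveSampling.momentConst (q + 2)) : ℝ≥0) : ℝ≥0∞)
        = 2 ^ (q - 1) * ENNReal.ofReal (LogConcaveSampling.momentConst (q + 2)) := by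
      change ENNReal.ofReal _ = _
      rw [ENNReal.ofReal_mul (by positivity), ← ENNReal.ofReal_rpow_of_pos (by norm_num),
        ENNReal.ofReal_ofNat]
    rw [e]
    calc _ ≤ 2 ^ (q - 1) * (ENNReal.ofReal α * (ENNReal.ofReal (LogConcaveSampling.momentConst
          (q + 2)) * LogConcaveSampling.secondMoment (LogConcaveSampling.law π) ^ ((q + 2) / 2))) :=
          by gcongr
      _ = _ := by ring
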